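/- **Notation.** Let $\mathbb H$ be the skew field of real quaternions; $M^*$ is the conjugate transpose and $\operatorname{rk} M$ the rank (dimension of the right column space) of a quaternion matrix $M$. The index $\operatorname{Ind} M$ of a square matrix is the smallest positive integer $k$ with $\operatorname{rk} M^{k+1}=\operatorname{rk} M^k$. For $M=(m_{ij})\in\mathbb H^{n\times n}$ and $1\le i\le n$, the $i$-th row determinant is $$\operatorname{rdet}_i M=\sum_{\sigma\in S_n}(-1)^{n-q}\,(m_{i\,\sigma(i)}m_{\sigma(i)\,\sigma^2(i)}\cdots m_{\sigma^{l_1}(i)\,i})\,(m_{c_2\,\sigma(c_2)}\cdots m_{\sigma^{l_2}(c_2)\,c_2})\cdots(m_{c_q\,\sigma(c_q)}\cdots m_{\sigma^{l_q}(c_q)\,c_q}),$$ where $q$ is the number of cycles of $\sigma$ (fixed points included), the first cycle starts with $i$, each other cycle starts with its least element $c_t$, and $c_2<\cdots<c_q$. If $M$ is Hermitian, all $\operatorname{rdet}_i M$ are equal, and this common value is $\det M$. The determinant of the empty matrix is $1$. $I_{r,n}$ is the set of $r$-element subsets of $\{1,\dots,n\}$, and $I_{r,n}\{j\}$ is the set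 of those that contain $j$. $M_\alpha^\alpha$ is the principal submatrix with rows and columns indexed by $\alpha$, and $|M|_\alpha^\alpha=\det M_\alpha^\alpha$ for Hermitian $M$. $M_{j.}(b)$ is $M$ with its $j$-th row replaced by the row $b$; in $\operatorname{rdet}_j(\,\cdot\,)_\alpha^\alpha$ the index $j$ refers to the row of the submatrix that comes from row $j$. For $A\in\mathbb H^{m\times n}$, $A^\dagger$ is the Moore–Penrose inverse, the unique $Y$ with $AYA=A$, $YAY=Y$, $(AY)^*=AY$, $(YA)^*=YA$. For $W\in\mathbb H^{n\times m}$, $A^{d,W}$ is the $W$-weighted Drazin inverse, the unique $X$ with $(AW)^{p+1}XW=(AW)^p$, $XWAWX=X$, $AWX=XWA$, where $p=\operatorname{Ind}(AW)$. For $W\neq0$, the $W$-weighted DMP inverse of $A$ is $$A^{d,\dagger,W}=W A^{d,W} W A A^\dagger\in\mathbb H^{n\times m}.$$ **Theorem.** Let $A\in\mathbb H^{m\times n}$ with $\operatorname{rk}A=r$, let $W\in\mathbb H^{n\times m}$ be nonzero, put $U=WA$, $k=\max\{\operatorname{Ind}(WA),\operatorname{Ind}(AW)\}$ and $r_1=\operatorname{rk}U^k$.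 Then $A^{d,W}$ and $A^\dagger$ exist and are unique, all denominators below are nonzero, and $A^{d,\dagger,W}=(a_{ij}^{d,\dagger,W})$ has the following determinantal representations for $1\le i\le n$, $1\le j\le m$. (i) For arbitrary $WA$, put $B=U^{2k+1}(U^{2k+1})^*$. Then $$a^{d,\dagger,W}_{ij}=\frac{\sum_{\alpha\in I_{r,m}\{j\}}\operatorname{rdet}_j\big((AA^*)_{j.}(\widetilde\omega_{i.})\big)_\alpha^\alpha}{\sum_{\alpha\in I_{r,m}}|AA^*|_\alpha^\alpha\;\Big(\sum_{\alpha\in I_{r_1,n}}|B|_\alpha^\alpha\Big)^2},$$ where $\widetilde\omega_{i.}$ is the $i$-th row of $\widetilde\Omega=\Omega\,(WA)^{k+1}A^*$ and $\Omega=(\omega_{is})\in\mathbb H^{n\times n}$ is given by $$\omega_{is}=\sum_{\alpha\in I_{r_1,n}\{s\}}\operatorname{rdet}_s\big(B_{s.}(\widehat\phi_{i.})\big)_\alpha^\alpha,$$ with $\widehat\phi_{i.}$ the $i$-th row of $\widehat\Phi=WA\,\Phi\,U^{2k}(U^{2k+1})^*$, where $\Phi=(\phi_{lq})\in\mathbb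 H^{n\times n}$ is given by $$\phi_{lq}=\sum_{\alpha\in I_{r_1,n}\{q\}}\operatorname{rdet}_q\big(B_{q.}(\check u_{l.})\big)_\alpha^\alpha,$$ with $\check u_{l.}$ the $l$-th row of $\check U=U^k(U^{2k+1})^*$. (ii) If $WA$ is Hermitian, then $$a^{d,\dagger,W}_{ij}=\frac{\sum_{\alpha\in I_{r,m}\{j\}}\operatorname{rdet}_j\big((AA^*)_{j.}(\widetilde\omega_{i.})\big)_\alpha^\alpha}{\sum_{\alpha\in I_{r,m}}|AA^*|_\alpha^\alpha\;\sum_{\alpha\in I_{r_1,n}}|(WA)^{k+2}|_\alpha^\alpha},$$ where $\widetilde\omega_{i.}$ is the $i$-th row of $\widetilde\Omega=\Omega\,WAA^*$ and $\Omega=(\omega_{is})\in\mathbb H^{n\times n}$ is given by $$\omega_{is}=\sum_{\alpha\in I_{r_1,n}\{s\}}\operatorname{rdet}_s\big(((WA)^{k+2})_{s.}(\widehat u_{i.})\big)_\alpha^\alpha,$$ with $\widehat u_{i.}$ the $i$-th row of $\widehat U=(WA)^{k+1}$. -/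

import Mathlib

open scoped Quaternion Matrix

namespace QMat

section RowDeterminant

variable {ι R : Type*} [Fintype ι] [LinearOrder ι] [Ring R]

/-- The ordered product `a_{x, σ x} * a_{σ x, σ² x} * ⋯ * a_{σ^l x, x}` of the entries of `M` along
the cycle of `σ` that starts with `x` (for a fixed point `x` this is `a_{x, x}`). -/
noncomputable def cycleProd (M : Matrix ι ι R) (σ : Equiv.Perm ι) (x : ι) : R :=
  ((List.range (Function.minimalPeriod σ x)).map fun t => M ((σ ^ t) x) ((σ ^ (t + 1)) x)).prod

/-- The first elements, from left to right, of the disjoint cycles (fixed points included) of the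
left-ordered cycle notation of `σ` with respect to `i`: the first cycle starts with `i`, every other
cycle starts with its least element, and these least elements increase from left to right. -/
def cycleStarts (σ : Equiv.Perm ι) (i : ι) : List ι :=
  i :: (Finset.univ.filter fun x : ι => ¬ σ.SameCycle i x ∧ ∀ y, σ.SameCycle x y → x ≤ y).sort
    (· ≤ ·)

/-- The `i`-th row determinant: `∑_σ (-1)^(n - r)` times the ordered product, over the `r` cycles of
the left-ordered cycle notation of `σ`, of the entries along these cycles. -/
noncomputable def rdet (M : Matrix ι ι R) (i : ι) : R :=
  ∑ σ : Equiv.Perm ι,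
    (-1 : R) ^ (Fintype.card ι - (cycleStarts σ i).length) *
      ((cycleStarts σ i).map (cycleProd M σ)).prod

/-- The determinant of a Hermitian matrix, the common value of all its row determinants: it is
computed along the first row, and it is `1` for the empty matrix. -/
noncomputable def hermDet (M : Matrix ι ι R) : R :=
  if h : (Finset.univ : Finset ι).Nonempty then rdet M (Finset.univ.min' h) else 1

/-- The principal submatrix with rows and columns indexed by `α`. -/
def principalSub (M : Matrix ι ι R) (α : Finset ι) : Matrix α α R :=
  M.submatrix Subtype.val Subtype.val

/-- `∑_{α ∈ I_r} |M|_α^α`: the sum of all principal minors of order `r` of a Hermitian matrix. -/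
noncomputable def minorSum (M : Matrix ι ι R) (r : ℕ) : R :=
  ∑ α ∈ Finset.powersetCard r (Finset.univ : Finset ι), hermDet (principalSub M α)

/-- `∑_{α ∈ I_r{j}} rdet_j (M_{j.}(b))_α^α`: the `j`-th row of `M` is replaced by `b`, and the `j`-th
row determinants of the principal submatrices with index set `α ∋ j` of size `r` are added. -/
noncomputable def rowMinorSum (M : Matrix ι ι R) (r : ℕ) (j : ι) (b : ι → R) : R :=
  ∑ α : {α : Finset ι // α.card = r ∧ j ∈ α},
    rdet (principalSub (M.updateRow j b) α.1) ⟨j, α.2.2⟩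

end RowDeterminant

section GeneralizedInverses

variable {m n : ℕ}

/-- The rank of a quaternion matrix: the dimension of its right column space, the span of its
columns for the multiplication by scalars from the right. -/
noncomputable def rk (A : Matrix (Fin m) (Fin n) ℍ[ℝ]) : ℕ :=
  Module.finrank ℍ[ℝ]ᵐᵒᵖ (Submodule.span ℍ[ℝ]ᵐᵒᵖ (Set.range A.col))

/-- The index: the smallest positive `k` with `rk (A ^ (k + 1)) = rk (A ^ k)`. -/
noncomputable def ind (A : Matrix (Fin n) (Fin n) ℍ[ℝ]) : ℕ :=
  sInf {k : ℕ | 0 < k ∧ rk (A ^ (k + 1)) = rk (A ^ k)}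

/-- `X` satisfies the four Penrose equations for `A`. -/
def IsMoorePenrose (A : Matrix (Fin m) (Fin n) ℍ[ℝ]) (X : Matrix (Fin n) (Fin m) ℍ[ℝ]) : Prop :=
  A * X * A = A ∧ X * A * X = X ∧ (A * X)ᴴ = A * X ∧ (X * A)ᴴ = X * A

/-- `X` satisfies the equations of the `W`-weighted Drazin inverse of `A`. -/
def IsWeightedDrazin (A : Matrix (Fin m) (Fin n) ℍ[ℝ]) (W : Matrix (Fin n) (Fin m) ℍ[ℝ])
    (X : Matrix (Fin m) (Fin n) ℍ[ℝ]) : Prop :=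
  (A * W) ^ (ind (A * W) + 1) * X * W = (A * W) ^ ind (A * W) ∧
    X * W * A * W * X = X ∧ A * W * X = X * W * A

open Classical in
/-- The Moore-Penrose inverse. -/
noncomputable def moorePenrose (A : Matrix (Fin m) (Fin n) ℍ[ℝ]) : Matrix (Fin n) (Fin m) ℍ[ℝ] :=
  if h : ∃ X, IsMoorePenrose A X then h.choose else 0

open Classical in
/-- The `W`-weighted Drazin inverse. -/
noncomputable def weightedDrazin (A : Matrix (Fin m) (Fin n) ℍ[ℝ])
    (W : Matrix (Fin n) (Fin m) ℍ[ℝ]) : Matrix (Fin m) (Fin n) ℍ[ℝ] :=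
  if h : ∃ X, IsWeightedDrazin A W X then h.choose else 0

/-- The `W`-weighted DMP inverse. -/
noncomputable def wdmp (A : Matrix (Fin m) (Fin n) ℍ[ℝ])
    (W : Matrix (Fin n) (Fin m) ℍ[ℝ]) : Matrix (Fin n) (Fin m) ℍ[ℝ] :=
  W * weightedDrazin A W * W * A * moorePenrose A

end GeneralizedInverses

end QMat

/-! Two facts are combined: an adjugate calculus for Hermitian quaternion matrices, and the
expression of each generalized inverse through inner inverses of Hermitian matrices.

For Hermitian `M`, let `adjSum M k` be the matrix by which a row `b` is multiplied to give the sums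
`rowMinorSum M k j b`, and let `e_k = minorSum M k`, which is real. Laplace expansion of row
determinants (`rowDetOn_updateRow`, `hasLaplace`) gives the Faddeev–LeVerrier recursion `adjSum M (k
+ 1) + M * adjSum M k = e_k • 1` (`adjSum_succ_add`). If `e_r` is the last nonzero `e_k`, the
recursion forces `M * adjSum M (r + 1) = 0`, so `M * adjSum M r * M = e_r • M`. A trace count shows
`r = rk M`. Hence the denominators do not vanish, and a matrix of row minor sums is a real multiple
of `C * innerInv M`, where `innerInv M` is a Hermitian inner inverse commuting with `M`.

On the other side, `A† = A* (AA*)⁻`, `W A^{d,W}` is the Drazin inverse `E` of `U = WA`, and so the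
weighted DMP inverse is `E U A†`. With `V = U^(2k+1)` the matrix `G = V* (VV*)⁻` is an inner inverse
of `V`, and `U^k G U^k = E`. Using this twice yields (i), with the square of the determinant sum
from the two uses. For Hermitian `U` one inner inverse of `U^(k+2)` suffices. -/

namespace QMat

set_option linter.unusedSectionVars false

/-! ### Row determinants as sums over permutations, and their expansion along a row. -/

section Combinatorics

variable {ι R : Type*} [Fintype ι] [LinearOrder ι] [Ring R]

open Equiv

/-- The permutations that fix every point outside `α`. -/
def permsOn (α : Finset ι) : Finset (Perm ι) :=
  Finset.univ.filter fun σ => ∀ x, x ∉ α → σ x = x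

/-- The least elements of the cycles of `σ` in `α`, in increasing order. -/
def cycleMins (σ : Perm ι) (α : Finset ι) : List ι :=
  (α.filter fun x => ∀ y, σ.SameCycle x y → x ≤ y).sort (· ≤ ·)

/-- The least elements of the cycles of `σ` in `α` that do not contain `j`, in increasing order. -/
def otherMins (σ : Perm ι) (α : Finset ι) (j : ι) : List ι :=
  (α.filter fun x => ¬ σ.SameCycle j x ∧ ∀ y, σ.SameCycle x y → x ≤ y).sort (· ≤ ·)

/-- The `j`-th row determinant of the principal submatrix with index set `α`, as a sum over
permutations of the whole index type. -/
noncomputable def rowDetOn (M : Matrix ι ι R) (α : Finset ι) (j : ι) : R :=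
  ∑ σ ∈ permsOn α, (-1 : R) ^ (α.card - ((otherMins σ α j).length + 1)) *
    (cycleProd M σ j * ((otherMins σ α j).map (cycleProd M σ)).prod)

/-- The determinant of the principal submatrix with index set `α`. -/
noncomputable def hermDetOn (M : Matrix ι ι R) (α : Finset ι) : R :=
  hermDet (principalSub M α)

lemma mem_permsOn {α : Finset ι} {σ : Perm ι} : σ ∈ permsOn α ↔ ∀ x, x ∉ α → σ x = x := by
  simp [permsOn]

lemma apply_mem_of_mem_permsOn {α : Finset ι} {σ : Perm ι} (h : σ ∈ permsOn α) {x : ι}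
    (hx : x ∈ α) : σ x ∈ α := by
  rw [mem_permsOn] at h
  by_contra hc
  have := σ.injective (h _ hc)
  exact hc (this.symm ▸ hx)

lemma pow_apply_mem {α : Finset ι} {σ : Perm ι} (h : σ ∈ permsOn α) {x : ι}
    (hx : x ∈ α) (t : ℕ) : (σ ^ t) x ∈ α := by
  induction t with
  | zero => simpa
  | succ t ih => rw [pow_succ', Perm.mul_apply]; exact apply_mem_of_mem_permsOn h ih

lemma sameCycle_iff_exists_nat {σ : Perm ι} {x y : ι} :
    σ.SameCycle x y ↔ ∃ t : ℕ, (σ ^ t) x = y :=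
  ⟨fun h => h.exists_nat_pow_eq, fun ⟨t, ht⟩ => ⟨t, by simpa using ht⟩⟩

lemma mem_of_sameCycle {α : Finset ι} {σ : Perm ι} (h : σ ∈ permsOn α) {x y : ι}
    (hx : x ∈ α) (hxy : σ.SameCycle x y) : y ∈ α := by
  obtain ⟨t, rfl⟩ := sameCycle_iff_exists_nat.1 hxy
  exact pow_apply_mem h hx t

lemma minimalPeriod_congr {κ : Type*} {σ : Perm ι} {τ : Perm κ} {x : ι} {y : κ}
    (h : ∀ t : ℕ, (σ ^ t) x = x ↔ (τ ^ t) y = y) :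
    Function.minimalPeriod σ x = Function.minimalPeriod τ y := by
  rw [Function.minimalPeriod_eq_minimalPeriod_iff]
  intro n
  simpa [Function.IsPeriodicPt, Function.IsFixedPt, ← Perm.coe_pow] using h n

lemma ofSubtype_pow_apply {α : Finset ι} (τ : Perm α) (t : ℕ) (x : α) :
    ((Perm.ofSubtype τ) ^ t) (x : ι) = ((τ ^ t) x : α) := by
  rw [← map_pow, Perm.ofSubtype_apply_coe]

lemma sameCycle_ofSubtype {α : Finset ι} (τ : Perm α) (x y : α) :
    (Perm.ofSubtype τ).SameCycle (x : ι) y ↔ τ.SameCycle x y := by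
  simp only [sameCycle_iff_exists_nat, ofSubtype_pow_apply, Subtype.coe_inj]

lemma cycleProd_principalSub (M : Matrix ι ι R) {α : Finset ι} (τ : Perm α) (x : α) :
    cycleProd (principalSub M α) τ x = cycleProd M (Perm.ofSubtype τ) x := by
  unfold cycleProd
  rw [minimalPeriod_congr (σ := τ) (τ := Perm.ofSubtype τ) (x := x) (y := (x : ι))]
  · simp only [ofSubtype_pow_apply]; rfl
  · intro t; rw [ofSubtype_pow_apply, Subtype.coe_inj]

lemma ofSubtype_mem_permsOn {α : Finset ι} (τ : Perm α) : Perm.ofSubtype τ ∈ permsOn α :=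
  mem_permsOn.2 fun _ hx => Perm.ofSubtype_apply_of_not_mem τ hx

lemma map_val_otherMins {α : Finset ι} (τ : Perm α) (i : α) :
    ((Finset.univ.filter fun x : α => ¬ τ.SameCycle i x ∧ ∀ y, τ.SameCycle x y → x ≤ y).sort
      (· ≤ ·)).map Subtype.val = otherMins (Perm.ofSubtype τ) α i := by
  have := Finset.map_sort (Function.Embedding.subtype (· ∈ α))
    (Finset.univ.filter fun x : α => ¬ τ.SameCycle i x ∧ ∀ y, τ.SameCycle x y → x ≤ y)
    (· ≤ ·) (· ≤ ·) (by simp)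
  refine (this.trans ?_)
  unfold otherMins
  congr 1
  ext x
  simp only [Finset.mem_map, Finset.mem_filter, Finset.mem_univ, true_and,
    Function.Embedding.subtype_apply]
  constructor
  · rintro ⟨x, ⟨h1, h2⟩, rfl⟩
    refine ⟨x.2, by rwa [sameCycle_ofSubtype], fun y hy => ?_⟩
    have hyα := mem_of_sameCycle (ofSubtype_mem_permsOn τ) x.2 hy
    exact h2 ⟨y, hyα⟩ ((sameCycle_ofSubtype τ x ⟨y, hyα⟩).1 hy)
  · rintro ⟨hx, h1, h2⟩
    refine ⟨⟨x, hx⟩, ⟨fun h => h1 ((sameCycle_ofSubtype τ i ⟨x, hx⟩).2 h), fun y hy => ?_⟩, rfl⟩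
    exact h2 y ((sameCycle_ofSubtype τ ⟨x, hx⟩ y).2 hy)

lemma sum_perm_subtype {S : Type*} [AddCommMonoid S] (α : Finset ι) (f : Perm ι → S) :
    ∑ τ : Perm α, f (Perm.ofSubtype τ) = ∑ σ ∈ permsOn α, f σ := by
  refine Finset.sum_bij (fun τ _ => Perm.ofSubtype τ) (fun τ _ => ofSubtype_mem_permsOn τ)
    (fun _ _ _ _ h => Perm.ofSubtype_injective h) (fun σ hσ => ?_) (fun _ _ => rfl)
  refine ⟨(Perm.subtypeEquivSubtypePerm (· ∈ α)).symm ⟨σ, mem_permsOn.1 hσ⟩, Finset.mem_univ _, ?_⟩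
  exact congrArg Subtype.val
    ((Perm.subtypeEquivSubtypePerm (· ∈ α)).apply_symm_apply ⟨σ, mem_permsOn.1 hσ⟩)

/-- Extending permutations by the identity outside `α` removes the subtypes, so that deleting an
index becomes `Finset.erase` in all later inductions. -/
lemma rdet_principalSub (M : Matrix ι ι R) (α : Finset ι) (j : α) :
    rdet (principalSub M α) j = rowDetOn M α j := by
  unfold rdet rowDetOn
  rw [← sum_perm_subtype α (fun σ => (-1 : R) ^ (α.card - ((otherMins σ α j).length + 1)) *
    (cycleProd M σ j * ((otherMins σ α j).map (cycleProd M σ)).prod))]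
  refine Finset.sum_congr rfl fun τ _ => ?_
  rw [← map_val_otherMins]
  simp [cycleStarts, cycleProd_principalSub]

lemma sort_filter_min {σ : Perm ι} {γ : Finset ι} (h : γ.Nonempty) (hσ : σ ∈ permsOn γ) :
    cycleMins σ γ = γ.min' h :: otherMins σ γ (γ.min' h) := by
  unfold cycleMins otherMins
  rw [← Finset.sort_insert]
  · congr 1
    ext x
    simp only [Finset.mem_insert, Finset.mem_filter]
    constructor
    · rintro ⟨hx, hm⟩
      by_cases hc : σ.SameCycle (γ.min' h) x
      · exact Or.inl (le_antisymm (hm _ hc.symm) (γ.min'_le x hx))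
      · exact Or.inr ⟨hx, hc, hm⟩
    · rintro (rfl | ⟨hx, -, hm⟩)
      · exact ⟨γ.min'_mem h, fun y hy => γ.min'_le y (mem_of_sameCycle hσ (γ.min'_mem h) hy)⟩
      · exact ⟨hx, hm⟩
  · intro b hb
    exact γ.min'_le b (Finset.mem_filter.1 hb).1
  · intro hm
    exact (Finset.mem_filter.1 hm).2.1 (Perm.SameCycle.refl _ _)

lemma min'_univ_coe {γ : Finset ι} (h : γ.Nonempty) (h' : (Finset.univ : Finset γ).Nonempty) :
    ((Finset.univ.min' h' : γ) : ι) = γ.min' h := by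
  apply le_antisymm
  · exact Finset.min'_le (Finset.univ : Finset γ) ⟨γ.min' h, γ.min'_mem h⟩ (Finset.mem_univ _)
  · exact γ.min'_le _ (Finset.univ.min' h').2

lemma hermDetOn_eq_rowDetOn (M : Matrix ι ι R) {γ : Finset ι} (h : γ.Nonempty) :
    hermDetOn M γ = rowDetOn M γ (γ.min' h) := by
  have h' : (Finset.univ : Finset γ).Nonempty := by
    simpa [Finset.univ_nonempty_iff] using h
  rw [hermDetOn, hermDet, dif_pos h', rdet_principalSub, min'_univ_coe h]

lemma hermDetOn_empty (M : Matrix ι ι R) : hermDetOn M ∅ = 1 := by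
  rw [hermDetOn, hermDet, dif_neg]
  simp

/-- The least element of `γ` is the least element of its own cycle, so starting there treats all
cycles alike. This form has no distinguished row and covers the empty set. -/
lemma hermDetOn_eq_sum (M : Matrix ι ι R) (γ : Finset ι) :
    hermDetOn M γ = ∑ σ ∈ permsOn γ, (-1 : R) ^ (γ.card - (cycleMins σ γ).length) *
      ((cycleMins σ γ).map (cycleProd M σ)).prod := by
  rcases γ.eq_empty_or_nonempty with rfl | h
  · have : permsOn (∅ : Finset ι) = {1} := by
      ext σ; simp [mem_permsOn, Perm.ext_iff]
    rw [hermDetOn_empty, this]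
    simp [cycleMins]
  · rw [hermDetOn_eq_rowDetOn M h]
    refine Finset.sum_congr rfl fun σ hσ => ?_
    rw [sort_filter_min h hσ]
    simp

lemma cycleProd_congr {M M' : Matrix ι ι R} {σ τ : Perm ι} {x : ι}
    (h : ∀ t : ℕ, (σ ^ t) x = (τ ^ t) x) (hM : ∀ y, σ.SameCycle x y → M y = M' y) :
    cycleProd M σ x = cycleProd M' τ x := by
  unfold cycleProd
  rw [minimalPeriod_congr (σ := σ) (τ := τ) (x := x) (y := x) (fun t => by rw [h])]
  congr 1
  refine List.map_congr_left fun t _ => ?_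
  rw [hM _ (sameCycle_iff_exists_nat.2 ⟨t, rfl⟩), h, h]

lemma sameCycle_congr {σ τ : Perm ι} {x y : ι}
    (h : ∀ t : ℕ, (σ ^ t) x = (τ ^ t) x) : σ.SameCycle x y ↔ τ.SameCycle x y := by
  simp only [sameCycle_iff_exists_nat, h]

lemma mem_of_sameCycle_of_closed {σ : Perm ι} {S : Set ι} {x y : ι} (hx : x ∈ S)
    (hS : ∀ z ∈ S, σ z ∈ S) (h : σ.SameCycle x y) : y ∈ S := by
  obtain ⟨t, rfl⟩ := sameCycle_iff_exists_nat.1 h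
  induction t with
  | zero => simpa
  | succ t ih =>
    rw [pow_succ', Perm.mul_apply]
    exact hS _ (ih (sameCycle_iff_exists_nat.2 ⟨t, rfl⟩))

section Contraction

variable {τ : Perm ι} {j s : ι}

lemma mul_swap_apply_left (hτ : τ s = s) : (τ * swap j s) j = s := by simp [hτ]

lemma mul_swap_apply_right : (τ * swap j s) s = τ j := by simp

lemma mul_swap_apply_of_ne {x : ι} (h1 : x ≠ j) (h2 : x ≠ s) : (τ * swap j s) x = τ x := by
  simp [swap_apply_of_ne_of_ne h1 h2]

lemma sameCycle_fixed_iff (hτ : τ s = s) {x : ι} : τ.SameCycle x s ↔ x = s := by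
  rw [Perm.sameCycle_comm]
  constructor
  · intro h
    exact (mem_of_sameCycle_of_closed (S := {s}) rfl (by rintro _ rfl; exact hτ) h)
  · rintro rfl; exact Perm.SameCycle.refl _ _

/-- Multiplying by `swap j s` on the right inserts the fixed point `s` of `τ` directly after `j` in
its cycle and leaves the other cycles alone. -/
lemma sameCycle_mul_swap (hτ : τ s = s) {x : ι} :
    (τ * swap j s).SameCycle j x ↔ τ.SameCycle j x ∨ x = s := by
  constructor
  · intro h
    refine mem_of_sameCycle_of_closed (S := {x | τ.SameCycle j x ∨ x = s})
      (Or.inl (Perm.SameCycle.refl _ _)) (fun z hz => ?_) h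
    by_cases h1 : z = j
    · right; rw [h1]; exact mul_swap_apply_left hτ
    by_cases h2 : z = s
    · left; rw [h2, mul_swap_apply_right]
      exact (Perm.sameCycle_apply_right).2 (Perm.SameCycle.refl _ _)
    · left
      rw [mul_swap_apply_of_ne h1 h2]
      exact (Perm.sameCycle_apply_right).2 (hz.resolve_right h2)
  · rintro (h | rfl)
    · refine mem_of_sameCycle_of_closed (S := {x | (τ * swap j s).SameCycle j x})
        (Perm.SameCycle.refl _ _) (fun z hz => ?_) h
      have hs : (τ * swap j s).SameCycle j s :=
        sameCycle_iff_exists_nat.2 ⟨1, by rw [pow_one]; exact mul_swap_apply_left hτ⟩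
      by_cases h1 : z = j
      · have := mul_swap_apply_right (τ := τ) (j := j) (s := s)
        rw [h1]
        show (τ * swap j s).SameCycle j (τ j)
        rw [← this]
        exact (Perm.sameCycle_apply_right).2 hs
      by_cases h2 : z = s
      · rw [h2, hτ]; exact hs
      · show (τ * swap j s).SameCycle j (τ z)
        rw [← mul_swap_apply_of_ne h1 h2]
        exact (Perm.sameCycle_apply_right).2 hz
    · exact sameCycle_iff_exists_nat.2 ⟨1, by rw [pow_one]; exact mul_swap_apply_left hτ⟩

lemma pow_mul_swap_apply (hτ : τ s = s) {x : ι} (hx : ¬ (τ * swap j s).SameCycle j x) (t : ℕ) :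
    ((τ * swap j s) ^ t) x = (τ ^ t) x := by
  induction t with
  | zero => rfl
  | succ t ih =>
    have key : ¬ (τ * swap j s).SameCycle j (((τ * swap j s) ^ t) x) := fun h =>
      hx (h.trans (Perm.SameCycle.symm (sameCycle_iff_exists_nat.2 ⟨t, rfl⟩)))
    rw [pow_succ', Perm.mul_apply (_ : Perm ι), mul_swap_apply_of_ne, ih, pow_succ', Perm.mul_apply]
    · intro h; exact key (by rw [h])
    · intro h; exact key (by rw [h]; exact (sameCycle_mul_swap hτ).2 (Or.inr rfl))

lemma otherMins_mul_swap (hτ : τ s = s) (α : Finset ι) :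
    otherMins (τ * swap j s) α j = otherMins τ (α.erase s) j := by
  unfold otherMins
  congr 1
  ext x
  simp only [Finset.mem_filter, Finset.mem_erase]
  constructor
  · rintro ⟨hx, h1, h2⟩
    have h3 := mt (sameCycle_mul_swap hτ).2 h1
    push Not at h3
    exact ⟨⟨h3.2, hx⟩, h3.1, fun y hy => h2 y
      ((sameCycle_congr (pow_mul_swap_apply hτ h1)).2 hy)⟩
  · rintro ⟨⟨hxs, hx⟩, h1, h2⟩
    have h3 : ¬ (τ * swap j s).SameCycle j x := by
      rw [sameCycle_mul_swap hτ]; push Not; exact ⟨h1, hxs⟩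
    exact ⟨hx, h3, fun y hy => h2 y ((sameCycle_congr (pow_mul_swap_apply hτ h3)).1 hy)⟩

lemma pow_succ_mul_swap_apply (hτ : τ s = s) (hjs : s ≠ j) {t : ℕ} (ht0 : 0 < t)
    (ht : t ≤ Function.minimalPeriod τ j) : ((τ * swap j s) ^ (t + 1)) j = (τ ^ t) j := by
  induction t with
  | zero => exact absurd ht0 (lt_irrefl _)
  | succ t ih =>
    rcases Nat.eq_zero_or_pos t with rfl | h0
    · rw [pow_succ', Perm.mul_apply, zero_add, pow_one, pow_one, mul_swap_apply_left hτ,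
        mul_swap_apply_right]
    · rw [pow_succ', Perm.mul_apply (_ : Perm ι), ih h0 (by omega), mul_swap_apply_of_ne, pow_succ',
        Perm.mul_apply]
      · intro h
        refine Function.not_isPeriodicPt_of_pos_of_lt_minimalPeriod (f := τ) (x := j) h0.ne'
          (by omega) ?_
        simpa [Function.IsPeriodicPt, Function.IsFixedPt, ← Perm.coe_pow] using h
      · intro h
        exact hjs ((sameCycle_fixed_iff hτ).1 (sameCycle_iff_exists_nat.2 ⟨t, h⟩)).symm

lemma minimalPeriod_pos (σ : Perm ι) (x : ι) : 0 < Function.minimalPeriod σ x := by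
  refine Function.minimalPeriod_pos_of_mem_periodicPts ?_
  refine Function.mk_mem_periodicPts (orderOf_pos σ) ?_
  simp [Function.IsPeriodicPt, Function.IsFixedPt, ← Perm.coe_pow, pow_orderOf_eq_one]

lemma minimalPeriod_mul_swap (hτ : τ s = s) (hjs : s ≠ j) :
    Function.minimalPeriod (τ * swap j s) j = Function.minimalPeriod τ j + 1 := by
  have hp := minimalPeriod_pos τ j
  apply le_antisymm
  · refine Function.IsPeriodicPt.minimalPeriod_le (Nat.succ_pos _) ?_
    have h := pow_succ_mul_swap_apply hτ hjs hp le_rfl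
    have h2 := Function.isPeriodicPt_minimalPeriod τ j
    simp only [Function.IsPeriodicPt, Function.IsFixedPt, ← Perm.coe_pow] at h2 ⊢
    rw [h, h2]
  · by_contra hc
    push Not at hc
    have h2 := Function.isPeriodicPt_minimalPeriod (τ * swap j s) j
    have h0 := minimalPeriod_pos (τ * swap j s) j
    generalize Function.minimalPeriod (τ * swap j s) j = q at *
    simp only [Function.IsPeriodicPt, Function.IsFixedPt, ← Perm.coe_pow] at h2
    obtain ⟨q, rfl⟩ := Nat.exists_eq_succ_of_ne_zero h0.ne'
    rcases Nat.eq_zero_or_pos q with rfl | hq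
    · rw [Nat.succ_eq_add_one, zero_add, pow_one, mul_swap_apply_left hτ] at h2
      exact hjs h2
    · rw [Nat.succ_eq_add_one, pow_succ_mul_swap_apply hτ hjs hq (by omega)] at h2
      refine Function.not_isPeriodicPt_of_pos_of_lt_minimalPeriod (f := τ) (x := j) hq.ne'
          (by omega) ?_
      simpa [Function.IsPeriodicPt, Function.IsFixedPt, ← Perm.coe_pow] using h2

/-- The longer cycle runs `j → s → τ j → ⋯`. After its first factor `b s`, the step out of `s` can
be read as the step out of `j` once row `j` is replaced by row `s`. -/
lemma cycleProd_mul_swap (M : Matrix ι ι R) (b : ι → R) (hτ : τ s = s) (hjs : s ≠ j) :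
    cycleProd (M.updateRow j b) (τ * swap j s) j =
      b s * cycleProd (M.updateRow j (M s)) τ j := by
  unfold cycleProd
  rw [minimalPeriod_mul_swap hτ hjs, List.range_succ_eq_map, List.map_cons, List.prod_cons,
    List.map_map]
  congr 1
  · rw [zero_add, pow_one, mul_swap_apply_left hτ]
    simp
  · congr 1
    refine List.map_congr_left fun t ht => ?_
    rw [List.mem_range] at ht
    simp only [Function.comp_apply, Nat.succ_eq_add_one]
    rw [pow_succ_mul_swap_apply hτ hjs (Nat.succ_pos t) ht]
    rcases Nat.eq_zero_or_pos t with rfl | h0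
    · rw [zero_add, pow_one, mul_swap_apply_left hτ, Matrix.updateRow_ne hjs]
      simp
    · rw [pow_succ_mul_swap_apply hτ hjs h0 ht.le]
      have : (τ ^ t) j ≠ j := fun h =>
        Function.not_isPeriodicPt_of_pos_of_lt_minimalPeriod (f := τ) (x := j) h0.ne' ht
          (by simpa [Function.IsPeriodicPt, Function.IsFixedPt, ← Perm.coe_pow] using h)
      rw [Matrix.updateRow_ne this, Matrix.updateRow_ne this]

end Contraction

lemma length_otherMins_lt {σ : Perm ι} {α : Finset ι} {j : ι} (hj : j ∈ α) :
    (otherMins σ α j).length < α.card := by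
  unfold otherMins
  rw [Finset.length_sort]
  refine Finset.card_lt_card ?_
  rw [Finset.filter_ssubset]
  exact ⟨j, hj, fun h => h.1 (Perm.SameCycle.refl _ _)⟩

lemma map_cycleProd_otherMins_congr {M M' : Matrix ι ι R} {σ τ : Perm ι} {α : Finset ι} {j : ι}
    (h : ∀ x, ¬ σ.SameCycle j x → ∀ t : ℕ, (σ ^ t) x = (τ ^ t) x)
    (hM : ∀ x, x ≠ j → M x = M' x) :
    (otherMins σ α j).map (cycleProd M σ) = (otherMins σ α j).map (cycleProd M' τ) := by
  refine List.map_congr_left fun x hx => ?_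
  have hx' : ¬ σ.SameCycle j x := by
    unfold otherMins at hx
    rw [Finset.mem_sort] at hx
    exact (Finset.mem_filter.1 hx).2.1
  refine cycleProd_congr (h x hx') fun y hy => hM y ?_
  rintro rfl
  exact hx' hy.symm

/-- The coefficients of the expansion of a row determinant along its distinguished row. -/
noncomputable def adjOn (M : Matrix ι ι R) (α : Finset ι) (s t : ι) : R :=
  if s = t then hermDetOn M (α.erase t) else -rowDetOn (M.updateRow t (M s)) (α.erase s) t

lemma sum_permsOn_fixed (M : Matrix ι ι R) {α : Finset ι} {j : ι} (hj : j ∈ α) (b : ι → R) :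
    ∑ σ ∈ (permsOn α).filter (fun σ => σ j = j),
      (-1 : R) ^ (α.card - ((otherMins σ α j).length + 1)) *
        (cycleProd (M.updateRow j b) σ j *
          ((otherMins σ α j).map (cycleProd (M.updateRow j b) σ)).prod) =
      b j * hermDetOn M (α.erase j) := by
  have hset : (permsOn α).filter (fun σ => σ j = j) = permsOn (α.erase j) := by
    ext σ
    simp only [Finset.mem_filter, mem_permsOn, Finset.mem_erase, not_and_or, not_not]
    constructor
    · rintro ⟨h1, h2⟩ x (rfl | hx)
      · exact h2
      · exact h1 x hx
    · intro h
      exact ⟨fun x hx => h x (Or.inr hx), h j (Or.inl rfl)⟩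
  rw [hset, hermDetOn_eq_sum, Finset.mul_sum]
  refine Finset.sum_congr rfl fun σ hσ => ?_
  have hσj : σ j = j := mem_permsOn.1 hσ j (Finset.notMem_erase _ _)
  have hcyc : ∀ x, σ.SameCycle j x ↔ x = j := fun x => by
    rw [Perm.sameCycle_comm, sameCycle_fixed_iff hσj]
  have hL : otherMins σ α j = cycleMins σ (α.erase j) := by
    unfold otherMins cycleMins
    congr 1
    ext x
    simp only [Finset.mem_filter, hcyc, Finset.mem_erase]
    tauto
  have hper : Function.minimalPeriod σ j = 1 := Function.minimalPeriod_eq_one_iff_isFixedPt.2 hσj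
  have hcp : cycleProd (M.updateRow j b) σ j = b j := by
    unfold cycleProd
    rw [hper]
    simp [hσj]
  rw [map_cycleProd_otherMins_congr (M' := M) (τ := σ) (fun _ _ _ => rfl)
    (fun x hx => by ext; rw [Matrix.updateRow_ne hx]), hcp, hL, Finset.card_erase_of_mem hj,
    ← mul_assoc, ← mul_assoc, Nat.sub_add_eq, Nat.sub_right_comm]
  congr 1
  exact ((Commute.neg_one_left (b j)).pow_left _).eq

/-- Contracting `s` out of the cycle of `j` removes one index but no cycle, hence the minus sign. -/
lemma sum_permsOn_moved (M : Matrix ι ι R) {α : Finset ι} {j s : ι} (hj : j ∈ α) (hs : s ∈ α)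
    (hjs : s ≠ j) (b : ι → R) :
    ∑ σ ∈ (permsOn α).filter (fun σ => σ j = s),
      (-1 : R) ^ (α.card - ((otherMins σ α j).length + 1)) *
        (cycleProd (M.updateRow j b) σ j *
          ((otherMins σ α j).map (cycleProd (M.updateRow j b) σ)).prod) =
      b s * -rowDetOn (M.updateRow j (M s)) (α.erase s) j := by
  have hset : (permsOn α).filter (fun σ => σ j = s) =
      (permsOn (α.erase s)).map (mulRightEmbedding (swap j s)) := by
    ext σ
    simp only [Finset.mem_filter, mem_permsOn, Finset.mem_map, mulRightEmbedding_apply,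
      Finset.mem_erase, not_and_or, not_not]
    constructor
    · rintro ⟨h1, h2⟩
      refine ⟨σ * swap j s, ?_, by simp [mul_assoc]⟩
      rintro x (rfl | hx)
      · simp [h2]
      · rw [mul_swap_apply_of_ne (by rintro rfl; exact hx hj) (by rintro rfl; exact hx hs)]
        exact h1 x hx
    · rintro ⟨τ, h, rfl⟩
      refine ⟨fun x hx => ?_, mul_swap_apply_left (h s (Or.inl rfl))⟩
      rw [mul_swap_apply_of_ne (by rintro rfl; exact hx hj) (by rintro rfl; exact hx hs)]
      exact h x (Or.inr hx)
  rw [hset, Finset.sum_map, rowDetOn, ← Finset.sum_neg_distrib, Finset.mul_sum]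
  refine Finset.sum_congr rfl fun τ hτ => ?_
  have hτs : τ s = s := mem_permsOn.1 hτ s (Finset.notMem_erase _ _)
  rw [mulRightEmbedding_apply]
  rw [map_cycleProd_otherMins_congr (M' := M.updateRow j (M s)) (τ := τ)
    (fun x hx => pow_mul_swap_apply hτs hx)
    (fun x hx => by ext; rw [Matrix.updateRow_ne hx, Matrix.updateRow_ne hx]),
    cycleProd_mul_swap M b hτs hjs, otherMins_mul_swap hτs]
  have hlt : (otherMins τ (α.erase s) j).length < (α.erase s).card :=
    length_otherMins_lt (Finset.mem_erase.2 ⟨hjs.symm, hj⟩)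
  rw [Finset.card_erase_of_mem hs] at hlt ⊢
  obtain ⟨d, hd⟩ := Nat.exists_eq_add_of_lt hlt
  have e1 : α.card - ((otherMins τ (α.erase s) j).length + 1) = d + 1 := by omega
  have e2 : α.card - 1 - ((otherMins τ (α.erase s) j).length + 1) = d := by omega
  rw [e1, e2, pow_succ]
  simp only [← mul_assoc, mul_neg, neg_mul, mul_one]
  rw [((Commute.neg_one_left (b s)).pow_left d).eq]

/-- Expansion of a row determinant along its distinguished row. -/
lemma rowDetOn_updateRow (M : Matrix ι ι R) {α : Finset ι} {j : ι} (hj : j ∈ α) (b : ι → R) :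
    rowDetOn (M.updateRow j b) α j = ∑ s ∈ α, b s * adjOn M α s j := by
  rw [rowDetOn, ← Finset.sum_fiberwise_of_maps_to (s := permsOn α) (t := α) (g := fun σ => σ j)
    (fun σ hσ => apply_mem_of_mem_permsOn hσ hj)]
  refine Finset.sum_congr rfl fun s hs => ?_
  by_cases hjs : s = j
  · subst hjs
    rw [sum_permsOn_fixed M hj, adjOn, if_pos rfl]
  · rw [sum_permsOn_moved M hj hs hjs, adjOn, if_neg hjs]

lemma rowDetOn_eq_sum (M : Matrix ι ι R) {α : Finset ι} {j : ι} (hj : j ∈ α) :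
    rowDetOn M α j = ∑ s ∈ α, M j s * adjOn M α s j := by
  conv_lhs => rw [← Matrix.updateRow_eq_self M j]
  exact rowDetOn_updateRow M hj _

lemma adjOn_self (M : Matrix ι ι R) (α : Finset ι) (t : ι) :
    adjOn M α t t = hermDetOn M (α.erase t) := if_pos rfl

lemma adjOn_of_ne (M : Matrix ι ι R) {α : Finset ι} {s t : ι} (ht : t ∈ α) (hst : s ≠ t) :
    adjOn M α s t = -∑ u ∈ α.erase s, M s u * adjOn M (α.erase s) u t := by
  rw [adjOn, if_neg hst, rowDetOn_updateRow M (Finset.mem_erase.2 ⟨hst.symm, ht⟩)]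

end Combinatorics

/-! ### Self-adjoint quaternions are real and central. -/

section SelfAdjoint

lemma eq_coe_re_of_star_eq {x : ℍ[ℝ]} (h : star x = x) : x = (x.re : ℍ[ℝ]) :=
  Quaternion.star_eq_self.1 h

lemma mul_comm_of_star_eq {x : ℍ[ℝ]} (h : star x = x) (y : ℍ[ℝ]) : x * y = y * x := by
  rw [eq_coe_re_of_star_eq h]
  exact Quaternion.coe_commutes _ _

lemma smul_one_eq_coe (c : ℝ) : c • (1 : ℍ[ℝ]) = (c : ℍ[ℝ]) := by
  rw [← Quaternion.coe_mul_eq_smul, mul_one]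

lemma re_sum {κ : Type*} (s : Finset κ) (f : κ → ℍ[ℝ]) : (∑ i ∈ s, f i).re = ∑ i ∈ s, (f i).re :=
  map_sum (AddMonoidHom.mk' (fun q : ℍ[ℝ] => q.re) fun _ _ => rfl) f s

lemma conjTranspose_real_smul {κ l : Type*} (c : ℝ) (A : Matrix κ l ℍ[ℝ]) : (c • A)ᴴ = c • Aᴴ := by
  ext1 i j
  rw [Matrix.conjTranspose_apply, Matrix.smul_apply, Quaternion.star_smul]
  rfl

end SelfAdjoint

/-! ### Laplace expansion and equality of the row determinants of a Hermitian matrix. -/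

section HermitianDeterminant

variable {ι : Type*} [Fintype ι] [LinearOrder ι]

/-- The Laplace expansion for the principal submatrix with index set `α`: the matrix `adjOn M α` is
self-adjoint and is the adjugate of that submatrix, whose determinant is self-adjoint. -/
structure HasLaplace (M : Matrix ι ι ℍ[ℝ]) (α : Finset ι) : Prop where
  star_adjOn : ∀ s ∈ α, ∀ t ∈ α, star (adjOn M α s t) = adjOn M α t s
  adjOn_mul : ∀ t ∈ α, ∀ u ∈ α,
    ∑ s ∈ α, adjOn M α t s * M s u = if t = u then hermDetOn M α else 0
  star_det : star (hermDetOn M α) = hermDetOn M α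

/-- The `t`-th diagonal entry of the product of `adjOn M α` and the submatrix of `M`. -/
noncomputable def diagOn (M : Matrix ι ι ℍ[ℝ]) (α : Finset ι) (t : ι) : ℍ[ℝ] :=
  ∑ s ∈ α, adjOn M α t s * M s t

variable {M : Matrix ι ι ℍ[ℝ]} {α : Finset ι}

/-- Expanding along row `s`, then conjugating by the induction hypothesis and expanding again,
removes both `s` and `t`. In the result, exchanging `s` and `t` visibly amounts to applying `star`.
-/
lemma adjOn_eq_double_sum (hM : M.IsHermitian)
    (ih : ∀ β, β ⊂ α → HasLaplace M β) {s t : ι} (hs : s ∈ α) (ht : t ∈ α) (hst : s ≠ t) :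
    adjOn M α s t = -(M s t * hermDetOn M ((α.erase s).erase t)) +
      ∑ u ∈ (α.erase s).erase t, ∑ v ∈ (α.erase s).erase t,
        M s u * adjOn M ((α.erase s).erase t) u v * M v t := by
  have ht' : t ∈ α.erase s := Finset.mem_erase.2 ⟨hst.symm, ht⟩
  rw [adjOn_of_ne M ht hst, ← Finset.add_sum_erase _ _ ht', adjOn_self, neg_add,
    ← Finset.sum_neg_distrib]
  congr 1
  refine Finset.sum_congr rfl fun u hu => ?_
  obtain ⟨hut, hu'⟩ := Finset.mem_erase.1 hu
  have ih1 := ih _ (Finset.erase_ssubset hs)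
  have ih2 := ih _ ((Finset.erase_ssubset ht').trans (Finset.erase_ssubset hs))
  rw [← ih1.star_adjOn t ht' u hu', adjOn_of_ne M hu' hut.symm, star_neg, star_sum, mul_neg,
    neg_neg, Finset.mul_sum]
  refine Finset.sum_congr rfl fun v hv => ?_
  rw [star_mul, ih2.star_adjOn v hv u hu, hM.apply, mul_assoc]

lemma star_adjOn_of_ih (hM : M.IsHermitian)
    (ih : ∀ β, β ⊂ α → HasLaplace M β) {s t : ι} (hs : s ∈ α) (ht : t ∈ α) :
    star (adjOn M α s t) = adjOn M α t s := by
  by_cases hst : s = t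
  · subst hst
    rw [adjOn_self, (ih _ (Finset.erase_ssubset hs)).star_det]
  have ht' : t ∈ α.erase s := Finset.mem_erase.2 ⟨fun h => hst h.symm, ht⟩
  have ih2 := ih _ ((Finset.erase_ssubset ht').trans (Finset.erase_ssubset hs))
  rw [adjOn_eq_double_sum hM ih hs ht hst, adjOn_eq_double_sum hM ih ht hs (Ne.symm hst),
    Finset.erase_right_comm (a := t) (b := s), star_add, star_neg, star_mul, ih2.star_det,
    hM.apply, mul_comm_of_star_eq ih2.star_det, star_sum, Finset.sum_comm]
  congr 1
  refine Finset.sum_congr rfl fun u hu => ?_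
  rw [star_sum]
  refine Finset.sum_congr rfl fun v hv => ?_
  rw [star_mul, star_mul, hM.apply, hM.apply, ih2.star_adjOn u hu v hv, mul_assoc]

lemma sum_adjOn_mul (M : Matrix ι ι ℍ[ℝ]) {t : ι} (ht : t ∈ α) (u : ι) :
    ∑ s ∈ α, adjOn M α t s * M s u = hermDetOn M (α.erase t) * M t u -
      ∑ v ∈ α.erase t, M t v * ∑ s ∈ α.erase t, adjOn M (α.erase t) v s * M s u := by
  rw [← Finset.add_sum_erase _ _ ht, adjOn_self, sub_eq_add_neg]
  congr 1
  simp only [Finset.mul_sum]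
  rw [Finset.sum_comm, ← Finset.sum_neg_distrib]
  refine Finset.sum_congr rfl fun s hs => ?_
  obtain ⟨hst, hs'⟩ := Finset.mem_erase.1 hs
  rw [adjOn_of_ne M hs' hst.symm, neg_mul, Finset.sum_mul]
  simp only [mul_assoc]

lemma sum_adjOn_mul_of_ne (ih : ∀ β, β ⊂ α → HasLaplace M β) {t u : ι} (ht : t ∈ α)
    (hu : u ∈ α) (htu : t ≠ u) : ∑ s ∈ α, adjOn M α t s * M s u = 0 := by
  have ih1 := ih _ (Finset.erase_ssubset ht)
  have hu' : u ∈ α.erase t := Finset.mem_erase.2 ⟨htu.symm, hu⟩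
  rw [sum_adjOn_mul M ht, Finset.sum_congr rfl fun v hv => by rw [ih1.adjOn_mul v hv u hu'],
    mul_comm_of_star_eq ih1.star_det]
  simp [hu']

lemma star_diagOn (hM : M.IsHermitian) (ih : ∀ β, β ⊂ α → HasLaplace M β) {t : ι} (ht : t ∈ α) :
    star (diagOn M α t) = diagOn M α t := by
  have ih1 := ih _ (Finset.erase_ssubset ht)
  rw [diagOn, sum_adjOn_mul M ht, star_sub, star_mul, hM.apply, ih1.star_det,
    mul_comm_of_star_eq ih1.star_det, star_sum]
  congr 1
  simp only [Finset.mul_sum, star_sum]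
  rw [Finset.sum_comm]
  refine Finset.sum_congr rfl fun u hu => Finset.sum_congr rfl fun v hv => ?_
  rw [star_mul, star_mul, hM.apply, hM.apply, ih1.star_adjOn v hv u hu, mul_assoc]

lemma sum_mul_adjOn (hM : M.IsHermitian) (ih : ∀ β, β ⊂ α → HasLaplace M β) {s v : ι}
    (hs : s ∈ α) (hv : v ∈ α) :
    ∑ u ∈ α, M s u * adjOn M α u v = if s = v then diagOn M α s else 0 := by
  have h : star (∑ u ∈ α, adjOn M α v u * M u s) = ∑ u ∈ α, M s u * adjOn M α u v := by
    rw [star_sum]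
    refine Finset.sum_congr rfl fun u hu => ?_
    rw [star_mul, hM.apply, star_adjOn_of_ih hM ih hv hu]
  rw [← h]
  split_ifs with hsv
  · subst hsv
    exact star_diagOn hM ih hs
  · rw [sum_adjOn_mul_of_ne ih hv hs (Ne.symm hsv), star_zero]

lemma diagOn_eq_rowDetOn (hM : M.IsHermitian) (ih : ∀ β, β ⊂ α → HasLaplace M β) {t : ι}
    (ht : t ∈ α) : diagOn M α t = rowDetOn M α t := by
  rw [rowDetOn_eq_sum M ht, sum_mul_adjOn hM ih ht ht, if_pos rfl]

/-- Both products of `M` with the adjugate are the same real diagonal matrix `D`, so associativity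
of `M * adj * M` gives `D_s M_st = M_st D_t`, and a nonzero `M_st` cancels. -/
lemma diagOn_eq_of_apply_ne_zero (hM : M.IsHermitian) (ih : ∀ β, β ⊂ α → HasLaplace M β)
    {s t : ι} (hs : s ∈ α) (ht : t ∈ α) (hst : M s t ≠ 0) : diagOn M α s = diagOn M α t := by
  have h1 : ∑ v ∈ α, (∑ u ∈ α, M s u * adjOn M α u v) * M v t = diagOn M α s * M s t := by
    rw [Finset.sum_congr rfl fun v hv => by rw [sum_mul_adjOn hM ih hs hv]]
    simp [hs]
  have h2 : ∑ u ∈ α, M s u * (∑ v ∈ α, adjOn M α u v * M v t) = M s t * diagOn M α t := by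
    rw [← Finset.add_sum_erase _ _ ht, add_eq_left.2, diagOn]
    refine Finset.sum_eq_zero ?_
    intro u hu
    obtain ⟨hut, hu'⟩ := Finset.mem_erase.1 hu
    rw [sum_adjOn_mul_of_ne ih hu' ht hut, mul_zero]
  have h3 : ∑ v ∈ α, (∑ u ∈ α, M s u * adjOn M α u v) * M v t =
      ∑ u ∈ α, M s u * (∑ v ∈ α, adjOn M α u v * M v t) := by
    simp only [Finset.sum_mul, Finset.mul_sum, mul_assoc]
    exact Finset.sum_comm
  rw [h1, h2, ← mul_comm_of_star_eq (star_diagOn hM ih ht)] at h3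
  exact mul_right_cancel₀ hst h3

lemma continuous_rowDetOn (α : Finset ι) (t : ι) :
    Continuous fun M : Matrix ι ι ℍ[ℝ] => rowDetOn M α t := by
  have hc : ∀ (σ : Equiv.Perm ι) (x : ι),
      Continuous fun M : Matrix ι ι ℍ[ℝ] => cycleProd M σ x := fun σ x =>
    continuous_list_prod _ fun i _ => continuous_id.matrix_elem _ _
  refine continuous_finsetSum _ fun σ _ => continuous_const.mul ((hc σ t).mul ?_)
  exact continuous_list_prod _ fun i _ => hc σ i

/-- A vanishing entry `M s t` is handled by perturbation and continuity, which is why the induction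
hypothesis ranges over all Hermitian matrices. -/
lemma rowDetOn_eq_rowDetOn (ih : ∀ β, β ⊂ α → ∀ M : Matrix ι ι ℍ[ℝ], M.IsHermitian → HasLaplace M β)
    (hM : M.IsHermitian) {s t : ι} (hs : s ∈ α) (ht : t ∈ α) :
    rowDetOn M α s = rowDetOn M α t := by
  by_cases hst : s = t
  · rw [hst]
  have of_ne : ∀ M' : Matrix ι ι ℍ[ℝ], M'.IsHermitian → M' s t ≠ 0 →
      rowDetOn M' α s = rowDetOn M' α t := fun M' hM' h => by
    have ih' := fun β hβ => ih β hβ M' hM'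
    rw [← diagOn_eq_rowDetOn hM' ih' hs, ← diagOn_eq_rowDetOn hM' ih' ht]
    exact diagOn_eq_of_apply_ne_zero hM' ih' hs ht h
  by_cases h0 : M s t = 0
  · let E : ℝ → Matrix ι ι ℍ[ℝ] := fun ε =>
      M + ε • (Matrix.single s t (1 : ℍ[ℝ]) + Matrix.single t s 1)
    have hE : ∀ ε, (E ε).IsHermitian := fun ε => by
      show (M + ε • _)ᴴ = _
      rw [Matrix.conjTranspose_add, conjTranspose_real_smul, Matrix.conjTranspose_add,
        Matrix.conjTranspose_single, Matrix.conjTranspose_single, star_one, hM.eq,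
        add_comm (Matrix.single t s _)]
    have hEst : ∀ ε, E ε s t = (ε : ℍ[ℝ]) := fun ε => by
      simp [E, h0, hst, Ne.symm hst, smul_one_eq_coe]
    have hEc : Continuous E := by fun_prop
    have key : (fun ε => rowDetOn (E ε) α s) = fun ε => rowDetOn (E ε) α t :=
      Continuous.ext_on (dense_compl_singleton (0 : ℝ)) ((continuous_rowDetOn α s).comp hEc)
        ((continuous_rowDetOn α t).comp hEc) fun ε hε =>
          of_ne _ (hE ε) (by rw [hEst]; exact fun h => hε (Quaternion.coe_injective h))
    have := congrFun key 0
    simpa [E] using this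
  · exact of_ne M hM h0

theorem hasLaplace (α : Finset ι) : ∀ M : Matrix ι ι ℍ[ℝ], M.IsHermitian → HasLaplace M α := by
  induction α using Finset.strongInduction with
  | H α ih =>
    intro M hM
    have ih' := fun β hβ => ih β hβ M hM
    have hD : ∀ t ∈ α, hermDetOn M α = diagOn M α t := fun t ht => by
      rw [hermDetOn_eq_rowDetOn M ⟨t, ht⟩, diagOn_eq_rowDetOn hM ih' ht]
      exact rowDetOn_eq_rowDetOn ih hM (Finset.min'_mem _ _) ht
    refine ⟨fun s hs t ht => star_adjOn_of_ih hM ih' hs ht, fun t ht u hu => ?_, ?_⟩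
    · split_ifs with htu
      · subst htu
        rw [hD t ht, diagOn]
      · exact sum_adjOn_mul_of_ne ih' ht hu htu
    · rcases α.eq_empty_or_nonempty with rfl | ⟨t, ht⟩
      · rw [hermDetOn_empty, star_one]
      · rw [hD t ht, star_diagOn hM ih' ht]

lemma sum_mul_adjOn_eq (hM : M.IsHermitian) {s v : ι} (hs : s ∈ α) (hv : v ∈ α) :
    ∑ u ∈ α, M s u * adjOn M α u v = if s = v then hermDetOn M α else 0 := by
  have ih : ∀ β, β ⊂ α → HasLaplace M β := fun β _ => hasLaplace β M hM
  rw [sum_mul_adjOn hM ih hs hv]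
  split_ifs with h
  · have := (hasLaplace α M hM).adjOn_mul s hs s hs
    rwa [if_pos rfl] at this
  · rfl

end HermitianDeterminant

/-! ### Sums of principal minors and the Faddeev–LeVerrier recursion. -/

section MinorSums

variable {ι : Type*} [Fintype ι] [LinearOrder ι]

/-- The matrix of the linear map that sends a row `b` to the row of the sums
`rowMinorSum M k j b`. -/
noncomputable def adjSum (M : Matrix ι ι ℍ[ℝ]) (k : ℕ) : Matrix ι ι ℍ[ℝ] :=
  Matrix.of fun s j => ∑ α ∈ Finset.powersetCard k Finset.univ,
    if s ∈ α ∧ j ∈ α then adjOn M α s j else 0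

lemma adjSum_apply (M : Matrix ι ι ℍ[ℝ]) (k : ℕ) (s j : ι) :
    adjSum M k s j = ∑ α ∈ Finset.powersetCard k Finset.univ,
      if s ∈ α ∧ j ∈ α then adjOn M α s j else 0 := rfl

lemma sum_mul_adjSum (M : Matrix ι ι ℍ[ℝ]) (k : ℕ) (b : ι → ℍ[ℝ]) (j : ι) :
    ∑ s, b s * adjSum M k s j = ∑ α ∈ Finset.powersetCard k Finset.univ,
      if j ∈ α then ∑ s ∈ α, b s * adjOn M α s j else 0 := by
  simp only [adjSum_apply, Finset.mul_sum]
  rw [Finset.sum_comm]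
  refine Finset.sum_congr rfl fun α _ => ?_
  split_ifs with hj
  · simp [hj, Finset.sum_ite_mem]
  · simp [hj]

lemma rowMinorSum_eq (M : Matrix ι ι ℍ[ℝ]) (k : ℕ) (j : ι) (b : ι → ℍ[ℝ]) :
    rowMinorSum M k j b = ∑ s, b s * adjSum M k s j := by
  rw [sum_mul_adjSum, ← Finset.sum_filter, rowMinorSum]
  simp only [rdet_principalSub]
  rw [Finset.sum_subtype ((Finset.powersetCard k Finset.univ).filter (j ∈ ·))
    (p := fun α : Finset ι => α.card = k ∧ j ∈ α) (by simp)]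
  exact Finset.sum_congr rfl fun α _ => rowDetOn_updateRow M α.2.2 b

lemma minorSum_eq (M : Matrix ι ι ℍ[ℝ]) (k : ℕ) :
    minorSum M k = ∑ α ∈ Finset.powersetCard k Finset.univ, hermDetOn M α := rfl

lemma minorSum_zero (M : Matrix ι ι ℍ[ℝ]) : minorSum M 0 = 1 := by
  simp [minorSum_eq, hermDetOn_empty]

lemma minorSum_of_card_lt (M : Matrix ι ι ℍ[ℝ]) {k : ℕ} (hk : Fintype.card ι < k) :
    minorSum M k = 0 := by
  rw [minorSum_eq, Finset.powersetCard_eq_empty.2 (by simpa using hk), Finset.sum_empty]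

lemma adjSum_of_card_lt (M : Matrix ι ι ℍ[ℝ]) {k : ℕ} (hk : Fintype.card ι < k) :
    adjSum M k = 0 := by
  ext1 s j
  rw [adjSum_apply, Finset.powersetCard_eq_empty.2 (by simpa using hk), Finset.sum_empty]
  rfl

lemma adjSum_zero (M : Matrix ι ι ℍ[ℝ]) : adjSum M 0 = 0 := by
  ext1 s j
  simp [adjSum_apply]

lemma sum_powersetCard_succ_mem (k : ℕ) (t : ι) (f : Finset ι → ℍ[ℝ]) :
    (∑ β ∈ Finset.powersetCard (k + 1) Finset.univ, if t ∈ β then f β else 0) =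
      ∑ α ∈ Finset.powersetCard k Finset.univ, if t ∉ α then f (insert t α) else 0 := by
  rw [← Finset.sum_filter, ← Finset.sum_filter]
  refine Finset.sum_bij' (fun β _ => β.erase t) (fun α _ => insert t α) ?_ ?_ ?_ ?_ ?_
  · intro β hβ
    simp only [Finset.mem_filter, Finset.mem_powersetCard, Finset.subset_univ, true_and] at hβ ⊢
    rw [Finset.card_erase_of_mem hβ.2, hβ.1]
    simp
  · intro α hα
    simp only [Finset.mem_filter, Finset.mem_powersetCard, Finset.subset_univ, true_and] at hα ⊢
    rw [Finset.card_insert_of_notMem hα.2, hα.1]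
    simp
  · intro β hβ
    exact Finset.insert_erase (Finset.mem_filter.1 hβ).2
  · intro α hα
    exact Finset.erase_insert (Finset.mem_filter.1 hα).2
  · intro β hβ
    rw [Finset.insert_erase (Finset.mem_filter.1 hβ).2]

lemma adjSum_succ_apply (M : Matrix ι ι ℍ[ℝ]) (k : ℕ) (t j : ι) :
    adjSum M (k + 1) t j = ∑ α ∈ Finset.powersetCard k Finset.univ,
      if t ∉ α then (if j ∈ insert t α then adjOn M (insert t α) t j else 0) else 0 := by
  rw [adjSum_apply, ← sum_powersetCard_succ_mem k t
    (fun β => if j ∈ β then adjOn M β t j else 0)]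
  refine Finset.sum_congr rfl fun β _ => ?_
  rw [ite_and]

lemma adjSum_succ_self (M : Matrix ι ι ℍ[ℝ]) (k : ℕ) (t : ι) :
    adjSum M (k + 1) t t = ∑ α ∈ Finset.powersetCard k Finset.univ,
      if t ∉ α then hermDetOn M α else 0 := by
  rw [adjSum_succ_apply]
  refine Finset.sum_congr rfl fun α _ => ?_
  by_cases h : t ∈ α
  · simp [h]
  · simp [h, adjOn_self, Finset.erase_insert h]

/-- Each minor of order `k` is counted once for every index outside its index set. -/
lemma trace_adjSum_succ (M : Matrix ι ι ℍ[ℝ]) {k : ℕ} (hk : k ≤ Fintype.card ι) :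
    (adjSum M (k + 1)).trace = ((Fintype.card ι : ℝ) - k) • minorSum M k := by
  simp only [Matrix.trace, Matrix.diag_apply, adjSum_succ_self]
  rw [Finset.sum_comm, minorSum_eq, Finset.smul_sum]
  refine Finset.sum_congr rfl fun α hα => ?_
  rw [← Finset.sum_filter, Finset.sum_const]
  have : (Finset.univ.filter fun t => t ∉ α) = αᶜ := by ext; simp
  rw [this, Finset.card_compl, (Finset.mem_powersetCard.1 hα).2, ← Nat.cast_smul_eq_nsmul ℝ,
    Nat.cast_sub hk]

variable {M : Matrix ι ι ℍ[ℝ]}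

lemma star_minorSum (hM : M.IsHermitian) (k : ℕ) : star (minorSum M k) = minorSum M k := by
  rw [minorSum_eq, star_sum]
  exact Finset.sum_congr rfl fun α _ => (hasLaplace α M hM).star_det

lemma minorSum_eq_coe (hM : M.IsHermitian) (k : ℕ) :
    minorSum M k = ((minorSum M k).re : ℍ[ℝ]) :=
  eq_coe_re_of_star_eq (star_minorSum hM k)

/-- On the diagonal, sets avoiding `t` contribute to the first term and sets containing `t` to the
second. Off the diagonal, Laplace expansion kills the sets containing both `t` and `j`, and for `j ∈
α`, `t ∉ α` the term of `insert t α` cancels that of `α`. -/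
lemma adjSum_succ_add (hM : M.IsHermitian) (k : ℕ) :
    adjSum M (k + 1) + M * adjSum M k = (minorSum M k).re • (1 : Matrix ι ι ℍ[ℝ]) := by
  ext1 t j
  rw [Matrix.add_apply, Matrix.mul_apply, sum_mul_adjSum, Matrix.smul_apply]
  by_cases htj : t = j
  · subst htj
    rw [adjSum_succ_self, ← Finset.sum_add_distrib, Matrix.one_apply_eq]
    have : (minorSum M k).re • (1 : ℍ[ℝ]) = minorSum M k := by
      conv_rhs => rw [minorSum_eq_coe hM k]
      exact smul_one_eq_coe _
    rw [this, minorSum_eq]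
    refine Finset.sum_congr rfl fun α _ => ?_
    by_cases h : t ∈ α
    · simp [h, sum_mul_adjOn_eq hM h h]
    · simp [h]
  · rw [adjSum_succ_apply, ← Finset.sum_add_distrib, Matrix.one_apply_ne htj, smul_zero]
    refine Finset.sum_eq_zero fun α _ => ?_
    have hjt : j ≠ t := Ne.symm htj
    by_cases hj : j ∈ α
    · by_cases h : t ∈ α
      · simp [h, hj, sum_mul_adjOn_eq hM h hj, htj]
      · simp only [h, not_false_iff, if_true, hj, Finset.mem_insert, or_true]
        rw [adjOn_of_ne M (Finset.mem_insert_of_mem hj) htj, Finset.erase_insert h,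
          neg_add_cancel]
    · simp [hj, hjt]

lemma adjSum_succ (hM : M.IsHermitian) (k : ℕ) :
    adjSum M (k + 1) = (minorSum M k).re • (1 : Matrix ι ι ℍ[ℝ]) - M * adjSum M k :=
  eq_sub_of_add_eq (adjSum_succ_add hM k)

lemma commute_adjSum (hM : M.IsHermitian) (k : ℕ) : Commute M (adjSum M k) := by
  induction k with
  | zero => rw [adjSum_zero]; exact Commute.zero_right M
  | succ k ih =>
    rw [adjSum_succ hM]
    exact ((Commute.one_right M).smul_right _).sub_right ((Commute.refl M).mul_right ih)

lemma isHermitian_adjSum (hM : M.IsHermitian) (k : ℕ) : (adjSum M k).IsHermitian := by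
  induction k with
  | zero => rw [adjSum_zero]; exact Matrix.isHermitian_zero
  | succ k ih =>
    rw [adjSum_succ hM]
    show _ᴴ = _
    rw [Matrix.conjTranspose_sub, conjTranspose_real_smul, Matrix.conjTranspose_one,
      Matrix.conjTranspose_mul, hM.eq, ih.eq, (commute_adjSum hM k).eq]

end MinorSums

/-! ### Cancellation from positivity of the norm. -/

section Definiteness

variable {ι κ l : Type*} [Fintype ι] [Fintype κ] [Fintype l]

lemma eq_zero_of_conjTranspose_mul_self {X : Matrix ι κ ℍ[ℝ]} (h : Xᴴ * X = 0) : X = 0 := by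
  ext1 i j
  have h1 := congrFun (congrFun h j) j
  simp only [Matrix.mul_apply, Matrix.conjTranspose_apply, Quaternion.star_mul_self,
    Matrix.zero_apply] at h1
  have h2 : ∑ i, Quaternion.normSq (X i j) = 0 := by
    have := congrArg (fun q : ℍ[ℝ] => q.re) h1
    simpa [re_sum] using this
  have h3 := (Finset.sum_eq_zero_iff_of_nonneg fun i _ => Quaternion.normSq_nonneg).1 h2 i
    (Finset.mem_univ i)
  exact Quaternion.normSq_eq_zero.1 h3

lemma mul_eq_zero_of_conjTranspose_mul {A : Matrix ι κ ℍ[ℝ]} {X : Matrix κ l ℍ[ℝ]}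
    (h : Aᴴ * (A * X) = 0) : A * X = 0 := by
  apply eq_zero_of_conjTranspose_mul_self
  rw [Matrix.conjTranspose_mul, Matrix.mul_assoc, h, Matrix.mul_zero]

lemma mul_eq_zero_of_pow_mul [DecidableEq ι] {M : Matrix ι ι ℍ[ℝ]} (hM : M.IsHermitian)
    {X : Matrix ι κ ℍ[ℝ]} {i : ℕ} (h : M ^ (i + 1) * X = 0) : M * X = 0 := by
  induction i generalizing X with
  | zero => simpa using h
  | succ i ih =>
    rw [pow_succ, Matrix.mul_assoc] at h
    have := ih h
    apply mul_eq_zero_of_conjTranspose_mul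
    rwa [hM.eq]

end Definiteness

/-! ### The last nonvanishing sum of principal minors. -/

section TopMinorSum

variable {ι : Type*} [Fintype ι] [LinearOrder ι] {M : Matrix ι ι ℍ[ℝ]}

lemma exists_last_minorSum (M : Matrix ι ι ℍ[ℝ]) :
    ∃ r, r ≤ Fintype.card ι ∧ minorSum M r ≠ 0 ∧ ∀ k, r < k → minorSum M k = 0 := by
  classical
  refine ⟨Nat.findGreatest (fun k => minorSum M k ≠ 0) (Fintype.card ι), Nat.findGreatest_le _,
    ?_, fun k hk => ?_⟩
  · exact Nat.findGreatest_spec (P := fun k => minorSum M k ≠ 0) (Nat.zero_le _)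
      (by rw [minorSum_zero]; exact one_ne_zero)
  · by_cases h : k ≤ Fintype.card ι
    · exact not_not.1 (Nat.findGreatest_is_greatest hk h)
    · exact minorSum_of_card_lt M (not_le.1 h)

/-- Beyond `r` the recursion only multiplies by `-M`, while `adjSum` vanishes for orders exceeding
the size. So a power of `M` kills `adjSum M (r + 1)`, and for Hermitian `M` already the first power
does. -/
lemma mul_adjSum_last (hM : M.IsHermitian) {r : ℕ} (hr : ∀ k, r < k → minorSum M k = 0) :
    M * adjSum M (r + 1) = 0 := by
  have h : ∀ i, adjSum M (r + 1 + i) = (-M) ^ i * adjSum M (r + 1) := fun i => by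
    induction i with
    | zero => simp
    | succ i ih =>
      rw [← add_assoc, adjSum_succ hM, hr _ (by omega), ih, pow_succ', Matrix.mul_assoc,
        Matrix.neg_mul]
      simp
  refine mul_eq_zero_of_pow_mul hM (i := Fintype.card ι) ?_
  have h1 := h (Fintype.card ι + 1)
  rw [adjSum_of_card_lt M (by omega), neg_pow, Matrix.mul_assoc] at h1
  have h2 := congrArg (fun X => (-1 : Matrix ι ι ℍ[ℝ]) ^ (Fintype.card ι + 1) * X) h1
  simp only [Matrix.mul_zero, ← Matrix.mul_assoc, ← pow_add, ← two_mul] at h2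
  rw [pow_mul, neg_one_sq, one_pow, Matrix.one_mul] at h2
  exact h2.symm

end TopMinorSum

/-! ### Right column rank and traces of idempotents. -/

section Rank

variable {m n l : ℕ}

instance : Module.Finite ℍ[ℝ]ᵐᵒᵖ ℍ[ℝ] :=
  ⟨⟨{1}, by
    rw [eq_top_iff]
    intro x _
    rw [Finset.coe_singleton, Submodule.mem_span_singleton]
    exact ⟨MulOpposite.op x, by simp⟩⟩⟩

/-- The right column space of a quaternion matrix. -/
noncomputable def colSpace (A : Matrix (Fin m) (Fin n) ℍ[ℝ]) : Submodule ℍ[ℝ]ᵐᵒᵖ (Fin m → ℍ[ℝ]) :=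
  Submodule.span ℍ[ℝ]ᵐᵒᵖ (Set.range A.col)

lemma mem_colSpace {A : Matrix (Fin m) (Fin n) ℍ[ℝ]} {x : Fin m → ℍ[ℝ]} :
    x ∈ colSpace A ↔ ∃ y, A *ᵥ y = x := by
  rw [colSpace, Submodule.mem_span_range_iff_exists_fun]
  constructor
  · rintro ⟨c, rfl⟩
    refine ⟨fun i => (c i).unop, ?_⟩
    ext1 k
    simp [Matrix.mulVec, dotProduct, Matrix.col]
  · rintro ⟨y, rfl⟩
    refine ⟨fun i => MulOpposite.op (y i), ?_⟩
    ext1 k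
    simp [Matrix.mulVec, dotProduct, Matrix.col]

lemma colSpace_mul_le (A : Matrix (Fin m) (Fin n) ℍ[ℝ]) (B : Matrix (Fin n) (Fin l) ℍ[ℝ]) :
    colSpace (A * B) ≤ colSpace A := by
  intro x hx
  obtain ⟨y, rfl⟩ := mem_colSpace.1 hx
  exact mem_colSpace.2 ⟨B *ᵥ y, Matrix.mulVec_mulVec _ _ _⟩

lemma exists_eq_mul_of_colSpace_le {A : Matrix (Fin m) (Fin n) ℍ[ℝ]}
    {B : Matrix (Fin m) (Fin l) ℍ[ℝ]} (h : colSpace A ≤ colSpace B) : ∃ Y, A = B * Y := by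
  have h1 : ∀ k, ∃ y, B *ᵥ y = A.col k := fun k =>
    mem_colSpace.1 (h (Submodule.subset_span ⟨k, rfl⟩))
  choose y hy using h1
  refine ⟨Matrix.of fun i k => y k i, ?_⟩
  ext1 i k
  exact (congrFun (hy k) i).symm

lemma rk_mul_le (A : Matrix (Fin m) (Fin n) ℍ[ℝ]) (B : Matrix (Fin n) (Fin l) ℍ[ℝ]) :
    rk (A * B) ≤ rk A :=
  Submodule.finrank_mono (colSpace_mul_le A B)

lemma rk_eq_of_eq_mul {A : Matrix (Fin m) (Fin n) ℍ[ℝ]} {B : Matrix (Fin m) (Fin l) ℍ[ℝ]}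
    {X : Matrix (Fin l) (Fin n) ℍ[ℝ]} {Y : Matrix (Fin n) (Fin l) ℍ[ℝ]} (h1 : A = B * X)
    (h2 : B = A * Y) : rk A = rk B :=
  le_antisymm (h1 ▸ rk_mul_le B X) (h2 ▸ rk_mul_le A Y)

lemma exists_eq_mul_of_rk_eq {A : Matrix (Fin m) (Fin n) ℍ[ℝ]} {B : Matrix (Fin n) (Fin l) ℍ[ℝ]}
    (h : rk (A * B) = rk A) : ∃ Y, A = A * B * Y :=
  exists_eq_mul_of_colSpace_le
    (Submodule.eq_of_le_of_finrank_eq (colSpace_mul_le A B) h).ge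

/-- The quaternionic trace is not cyclic, but its real part is. -/
lemma re_mul_comm (a b : ℍ[ℝ]) : (a * b).re = (b * a).re := by
  simp only [Quaternion.re_mul]
  ring

lemma re_trace_mul_comm {ι κ : Type*} [Fintype ι] [Fintype κ] (A : Matrix ι κ ℍ[ℝ])
    (B : Matrix κ ι ℍ[ℝ]) : (A * B).trace.re = (B * A).trace.re := by
  simp only [Matrix.trace, Matrix.diag_apply, Matrix.mul_apply, re_sum]
  rw [Finset.sum_comm]
  simp only [re_mul_comm (A _ _)]

/-- The real part of the trace of an idempotent quaternion matrix is its rank. -/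
theorem re_trace_of_idempotent {P : Matrix (Fin n) (Fin n) ℍ[ℝ]} (hP : P * P = P) :
    P.trace.re = rk P := by
  -- A basis of the column space gives a full-rank factorization `P = C * F`. Idempotence forces `F
  -- * C = 1`, whose trace is the rank.
  let b := Module.finBasis ℍ[ℝ]ᵐᵒᵖ (colSpace P)
  have hcol : ∀ k, P.col k ∈ colSpace P := fun k => Submodule.subset_span ⟨k, rfl⟩
  let C : Matrix (Fin n) (Fin (Module.finrank ℍ[ℝ]ᵐᵒᵖ (colSpace P))) ℍ[ℝ] :=
    Matrix.of fun i j => (b j : Fin n → ℍ[ℝ]) i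
  let F : Matrix (Fin (Module.finrank ℍ[ℝ]ᵐᵒᵖ (colSpace P))) (Fin n) ℍ[ℝ] :=
    Matrix.of fun j k => (b.repr ⟨P.col k, hcol k⟩ j).unop
  have hCF : C * F = P := by
    ext1 i k
    have h := congrArg (fun x : colSpace P => (x : Fin n → ℍ[ℝ]) i)
      (b.sum_repr ⟨P.col k, hcol k⟩)
    simp only [Submodule.coe_sum, Submodule.coe_smul, Finset.sum_apply, Pi.smul_apply] at h
    exact h
  have hPC : P * C = C := by
    have h : ∀ j, P *ᵥ (b j : Fin n → ℍ[ℝ]) = b j := fun j => by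
      obtain ⟨y, hy⟩ := mem_colSpace.1 (b j).2
      rw [← hy, Matrix.mulVec_mulVec, hP]
    ext1 i j
    exact congrFun (h j) i
  have hinj : ∀ X : Matrix (Fin (Module.finrank ℍ[ℝ]ᵐᵒᵖ (colSpace P)))
      (Fin (Module.finrank ℍ[ℝ]ᵐᵒᵖ (colSpace P))) ℍ[ℝ], C * X = 0 → X = 0 := fun X hX => by
    ext1 j k
    have h0 : ∑ j, MulOpposite.op (X j k) • b j = 0 := by
      apply Subtype.ext
      ext1 i
      have := congrFun (congrFun hX i) k
      simp only [Submodule.coe_sum, Submodule.coe_smul, Finset.sum_apply, Pi.smul_apply]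
      exact this
    have := (Fintype.linearIndependent_iff.1 b.linearIndependent) _ h0 j
    exact MulOpposite.op_injective this
  have hFC : F * C = 1 := by
    rw [← sub_eq_zero]
    apply hinj
    rw [Matrix.mul_sub, ← Matrix.mul_assoc, hCF, hPC, Matrix.mul_one, sub_self]
  rw [← hCF, re_trace_mul_comm, hFC, hCF, Matrix.trace_one, Fintype.card_fin]
  exact Quaternion.re_natCast _

end Rank

/-! ### The rank of a Hermitian matrix from its minors, and its inner inverse. -/

section HermitianRank

variable {n : ℕ} {M : Matrix (Fin n) (Fin n) ℍ[ℝ]}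

/-- With `d = e_r`, the matrix `d⁻¹ • (M * adjSum M r)` is an idempotent with the column space of
`M`. By the recursion the real part of its trace is `n - (n - r) = r`. -/
lemma rk_eq_of_last_minorSum (hM : M.IsHermitian) {r : ℕ} (hrn : r ≤ n) (h0 : minorSum M r ≠ 0)
    (hr : ∀ k, r < k → minorSum M k = 0) : rk M = r := by
  have hd : (minorSum M r).re ≠ 0 := fun h => h0 (by rw [minorSum_eq_coe hM, h]; rfl)
  set d := (minorSum M r).re with hd_def
  have hMN : M * adjSum M r = d • (1 : Matrix _ _ ℍ[ℝ]) - adjSum M (r + 1) :=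
    eq_sub_of_add_eq' (adjSum_succ_add hM r)
  have hMMN : M * (M * adjSum M r) = d • M := by
    rw [hMN, Matrix.mul_sub, mul_adjSum_last hM hr, sub_zero, Matrix.mul_smul, Matrix.mul_one]
  have hc := (commute_adjSum hM r).eq
  have hPM : (d⁻¹ • (M * adjSum M r)) * M = M := by
    rw [Matrix.smul_mul, Matrix.mul_assoc, ← hc, hMMN, smul_smul, inv_mul_cancel₀ hd, one_smul]
  have hP : (d⁻¹ • (M * adjSum M r)) * (d⁻¹ • (M * adjSum M r)) = d⁻¹ • (M * adjSum M r) := by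
    rw [Matrix.mul_smul, ← Matrix.mul_assoc, hPM]
  have htr : ((d⁻¹ • (M * adjSum M r)).trace).re = r := by
    rw [Matrix.trace_smul, hMN, Matrix.trace_sub, trace_adjSum_succ M (by simpa using hrn),
      Matrix.trace_smul, Matrix.trace_one, Quaternion.re_smul, Quaternion.re_sub,
      Quaternion.re_smul, Quaternion.re_smul, Quaternion.re_natCast, ← hd_def, Fintype.card_fin]
    simp only [smul_eq_mul]
    field_simp
    ring
  have hrk : rk (d⁻¹ • (M * adjSum M r)) = rk M :=
    rk_eq_of_eq_mul (X := d⁻¹ • adjSum M r) (Matrix.mul_smul _ _ _).symm hPM.symm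
  rw [re_trace_of_idempotent hP, hrk] at htr
  exact_mod_cast htr

/-- The sum of the principal minors of order `rk M` of a Hermitian matrix does not vanish. -/
theorem minorSum_rk_ne_zero (hM : M.IsHermitian) : minorSum M (rk M) ≠ 0 := by
  obtain ⟨r, hrn, h0, hr⟩ := exists_last_minorSum M
  rwa [rk_eq_of_last_minorSum hM (by simpa using hrn) h0 hr]

theorem mul_adjSum_rk_mul (hM : M.IsHermitian) :
    M * adjSum M (rk M) * M = (minorSum M (rk M)).re • M := by
  obtain ⟨r, hrn, h0, hr⟩ := exists_last_minorSum M
  rw [rk_eq_of_last_minorSum hM (by simpa using hrn) h0 hr, Matrix.mul_assoc,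
    ← (commute_adjSum hM r).eq, eq_sub_of_add_eq' (adjSum_succ_add hM r), Matrix.mul_sub,
    mul_adjSum_last hM hr, sub_zero, Matrix.mul_smul, Matrix.mul_one]

/-- The scaled adjugate sum: a Hermitian inner inverse that commutes with `M`. -/
noncomputable def innerInv (M : Matrix (Fin n) (Fin n) ℍ[ℝ]) : Matrix (Fin n) (Fin n) ℍ[ℝ] :=
  (minorSum M (rk M)).re⁻¹ • adjSum M (rk M)

lemma re_minorSum_rk_ne_zero (hM : M.IsHermitian) : (minorSum M (rk M)).re ≠ 0 := fun h =>
  minorSum_rk_ne_zero hM (by rw [minorSum_eq_coe hM, h]; rfl)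

lemma adjSum_rk_eq (hM : M.IsHermitian) :
    adjSum M (rk M) = (minorSum M (rk M)).re • innerInv M := by
  rw [innerInv, smul_smul, mul_inv_cancel₀ (re_minorSum_rk_ne_zero hM), one_smul]

lemma mul_innerInv_mul (hM : M.IsHermitian) : M * innerInv M * M = M := by
  rw [innerInv, Matrix.mul_smul, Matrix.smul_mul, mul_adjSum_rk_mul hM, smul_smul,
    inv_mul_cancel₀ (re_minorSum_rk_ne_zero hM), one_smul]

lemma commute_innerInv (hM : M.IsHermitian) : Commute M (innerInv M) :=
  (commute_adjSum hM _).smul_right _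

lemma isHermitian_innerInv (hM : M.IsHermitian) : (innerInv M).IsHermitian := by
  show _ᴴ = _
  rw [innerInv, conjTranspose_real_smul, (isHermitian_adjSum hM _).eq]

/-- The rows with entries `rowMinorSum M (rk M) j (C.row i)` form a multiple of `C * innerInv M`. -/
lemma of_rowMinorSum_eq (hM : M.IsHermitian) {κ : Type*} {C X : Matrix κ (Fin n) ℍ[ℝ]}
    (hX : ∀ i j, X i j = rowMinorSum M (rk M) j (C.row i)) :
    X = (minorSum M (rk M)).re • (C * innerInv M) := by
  rw [← Matrix.mul_smul, ← adjSum_rk_eq hM]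
  ext1 i j
  rw [hX, rowMinorSum_eq]
  rfl

end HermitianRank

/-! ### The Moore–Penrose inverse as `A* (AA*)⁻`. -/

section MoorePenrose

variable {m n : ℕ}

lemma mul_conjTranspose_innerInv_mul (A : Matrix (Fin m) (Fin n) ℍ[ℝ]) :
    A * Aᴴ * innerInv (A * Aᴴ) * A = A := by
  have hH := Matrix.isHermitian_mul_conjTranspose_self A
  have h : (A * Aᴴ * innerInv (A * Aᴴ) * A - A)ᴴ = 0 := by
    apply eq_zero_of_conjTranspose_mul_self
    rw [Matrix.conjTranspose_conjTranspose]
    have h2 : (A * Aᴴ * innerInv (A * Aᴴ) * A - A) * Aᴴ = 0 := by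
      rw [Matrix.sub_mul, Matrix.mul_assoc _ A, mul_innerInv_mul hH, sub_self]
    rw [Matrix.conjTranspose_sub, Matrix.mul_sub, h2, sub_zero, Matrix.conjTranspose_mul,
      ← Matrix.mul_assoc, h2, Matrix.zero_mul]
  exact sub_eq_zero.1 (Matrix.conjTranspose_eq_zero.1 h)

lemma isMoorePenrose_innerInv (A : Matrix (Fin m) (Fin n) ℍ[ℝ]) :
    IsMoorePenrose A (Aᴴ * innerInv (A * Aᴴ)) := by
  have hH := Matrix.isHermitian_mul_conjTranspose_self A
  have hN := isHermitian_innerInv hH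
  have hc := (commute_innerInv hH).eq
  have h1 := mul_conjTranspose_innerInv_mul A
  have h1' : Aᴴ * (innerInv (A * Aᴴ) * (A * Aᴴ)) = Aᴴ := by
    have := congrArg Matrix.conjTranspose h1
    rwa [Matrix.conjTranspose_mul, Matrix.conjTranspose_mul, hN.eq, hH.eq] at this
  refine ⟨?_, ?_, ?_, ?_⟩
  · rw [← Matrix.mul_assoc, h1]
  · calc Aᴴ * innerInv (A * Aᴴ) * A * (Aᴴ * innerInv (A * Aᴴ))
        = Aᴴ * (innerInv (A * Aᴴ) * (A * Aᴴ)) * innerInv (A * Aᴴ) := by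
          simp only [Matrix.mul_assoc]
      _ = _ := by rw [h1']
  · rw [← Matrix.mul_assoc, Matrix.conjTranspose_mul, hN.eq, hH.eq, hc]
  · rw [Matrix.conjTranspose_mul, Matrix.conjTranspose_mul, hN.eq, Matrix.conjTranspose_conjTranspose,
      Matrix.mul_assoc]

lemma IsMoorePenrose.unique {A : Matrix (Fin m) (Fin n) ℍ[ℝ]} {X Y : Matrix (Fin n) (Fin m) ℍ[ℝ]}
    (hX : IsMoorePenrose A X) (hY : IsMoorePenrose A Y) : X = Y := by
  obtain ⟨x1, x2, x3, x4⟩ := hX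
  obtain ⟨y1, y2, y3, y4⟩ := hY
  have hAX : A * X = A * Y := by
    calc A * X = (A * Y) * (A * X) := by rw [← Matrix.mul_assoc, y1]
      _ = (A * Y)ᴴ * (A * X)ᴴ := by rw [x3, y3]
      _ = (A * X * A * Y)ᴴ := by rw [← Matrix.conjTranspose_mul]; simp only [Matrix.mul_assoc]
      _ = A * Y := by rw [x1, y3]
  have hXA : X * A = Y * A := by
    calc X * A = (X * A) * (Y * A) := by rw [Matrix.mul_assoc, ← Matrix.mul_assoc A, y1]
      _ = (X * A)ᴴ * (Y * A)ᴴ := by rw [x4, y4]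
      _ = (Y * (A * X * A))ᴴ := by rw [← Matrix.conjTranspose_mul]; simp only [Matrix.mul_assoc]
      _ = Y * A := by rw [x1, y4]
  calc X = X * A * X := x2.symm
    _ = Y * (A * X) := by rw [hXA, Matrix.mul_assoc]
    _ = Y := by rw [hAX, ← Matrix.mul_assoc, y2]

lemma existsUnique_isMoorePenrose (A : Matrix (Fin m) (Fin n) ℍ[ℝ]) : ∃! Y, IsMoorePenrose A Y :=
  ⟨_, isMoorePenrose_innerInv A, fun _ hY => hY.unique (isMoorePenrose_innerInv A)⟩

lemma moorePenrose_eq (A : Matrix (Fin m) (Fin n) ℍ[ℝ]) :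
    moorePenrose A = Aᴴ * innerInv (A * Aᴴ) := by
  have h : ∃ X, IsMoorePenrose A X := ⟨_, isMoorePenrose_innerInv A⟩
  rw [moorePenrose, dif_pos h]
  exact h.choose_spec.unique (isMoorePenrose_innerInv A)

lemma rk_mul_conjTranspose (A : Matrix (Fin m) (Fin n) ℍ[ℝ]) : rk (A * Aᴴ) = rk A :=
  rk_eq_of_eq_mul (X := Aᴴ) (Y := innerInv (A * Aᴴ) * A) rfl
    (by rw [← Matrix.mul_assoc, mul_conjTranspose_innerInv_mul])

end MoorePenrose

/-! ### Index, stabilization of powers and Drazin inverses. -/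

section Drazin

variable {m n : ℕ}

/-- Ranks of powers cannot decrease strictly forever, so the infimum is attained and is not the
default value `0` of `sInf ∅`. -/
lemma ind_spec (T : Matrix (Fin n) (Fin n) ℍ[ℝ]) :
    0 < ind T ∧ rk (T ^ (ind T + 1)) = rk (T ^ ind T) := by
  have hne : {k : ℕ | 0 < k ∧ rk (T ^ (k + 1)) = rk (T ^ k)}.Nonempty := by
    by_contra hc
    rw [Set.not_nonempty_iff_eq_empty, Set.eq_empty_iff_forall_notMem] at hc
    have hlt : ∀ k, rk (T ^ (k + 1 + 1)) < rk (T ^ (k + 1)) := fun k =>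
      lt_of_le_of_ne (by rw [pow_succ]; exact rk_mul_le _ _) fun h => hc (k + 1) ⟨k.succ_pos, h⟩
    have hbd : ∀ k, rk (T ^ (k + 1)) + k ≤ rk (T ^ 1) := fun k => by
      induction k with
      | zero => simp
      | succ k ih => have := hlt k; omega
    have := hbd (rk (T ^ 1) + 1)
    omega
  exact Nat.sInf_mem hne

lemma exists_pow_eq_pow_mul {T : Matrix (Fin n) (Fin n) ℍ[ℝ]} {p k : ℕ}
    (hp : rk (T ^ (p + 1)) = rk (T ^ p)) (hk : p ≤ k) (i : ℕ) :
    ∃ Y : Matrix (Fin n) (Fin n) ℍ[ℝ], T ^ k = T ^ (k + i) * Y := by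
  obtain ⟨Y, hY⟩ : ∃ Y : Matrix (Fin n) (Fin n) ℍ[ℝ], T ^ p = T ^ (p + 1) * Y := by
    rw [pow_succ] at hp ⊢
    exact exists_eq_mul_of_rk_eq hp
  have h1 : ∀ k, p ≤ k → T ^ k = T ^ (k + 1) * Y := fun k hk => by
    obtain ⟨j, hj⟩ := Nat.exists_eq_add_of_le' hk
    rw [hj, add_assoc, pow_add, pow_add T j (p + 1), Matrix.mul_assoc, ← hY]
  induction i with
  | zero => exact ⟨1, by simp⟩
  | succ i ih =>
    obtain ⟨Z, hZ⟩ := ih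
    refine ⟨Y * Z, ?_⟩
    rw [← add_assoc, ← Matrix.mul_assoc, ← h1 (k + i) (by omega)]
    exact hZ

/-- With `X = A†`, the idempotents `A * X` and `X * A` have the column spaces of `A` and `Aᴴ`, and
their traces have the same real part. -/
lemma rk_conjTranspose (A : Matrix (Fin m) (Fin n) ℍ[ℝ]) : rk Aᴴ = rk A := by
  obtain ⟨h1, -, -, h4⟩ := isMoorePenrose_innerInv A
  set X := Aᴴ * innerInv (A * Aᴴ) with hX
  have e1 : (A * X).trace.re = rk (A * X) :=
    re_trace_of_idempotent (by rw [← Matrix.mul_assoc, h1])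
  have e2 : (X * A).trace.re = rk (X * A) :=
    re_trace_of_idempotent (by rw [Matrix.mul_assoc, ← Matrix.mul_assoc A, h1])
  have e3 : rk (A * X) = rk A := rk_eq_of_eq_mul (X := X) (Y := A) rfl h1.symm
  have e4 : rk (X * A) = rk Aᴴ := by
    refine rk_eq_of_eq_mul (X := innerInv (A * Aᴴ) * A) (Y := Aᴴ) ?_ ?_
    · rw [hX, Matrix.mul_assoc]
    · rw [← h4, ← Matrix.conjTranspose_mul, ← Matrix.mul_assoc, h1]
  rw [re_trace_mul_comm, e2, e3, e4] at e1
  exact_mod_cast e1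

lemma exists_pow_eq_mul_pow {T : Matrix (Fin n) (Fin n) ℍ[ℝ]} {p k : ℕ}
    (hp : rk (T ^ (p + 1)) = rk (T ^ p)) (hk : p ≤ k) (i : ℕ) :
    ∃ Y : Matrix (Fin n) (Fin n) ℍ[ℝ], T ^ k = Y * T ^ (k + i) := by
  obtain ⟨Y, hY⟩ := exists_pow_eq_pow_mul (T := Tᴴ) (p := p) (by
    rw [← Matrix.conjTranspose_pow, ← Matrix.conjTranspose_pow, rk_conjTranspose,
      rk_conjTranspose, hp]) hk i
  refine ⟨Yᴴ, ?_⟩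
  have := congrArg Matrix.conjTranspose hY
  simpa only [Matrix.conjTranspose_mul, Matrix.conjTranspose_pow,
    Matrix.conjTranspose_conjTranspose] using this

/-- `E` is a Drazin inverse of `T` of exponent `p`. -/
structure IsDrazin {R : Type*} [Ring R] (T E : R) (p : ℕ) : Prop where
  comm : T * E = E * T
  outer : E * T * E = E
  pow_succ_mul : T ^ (p + 1) * E = T ^ p

section IsDrazin

variable {R : Type*} [Ring R] {T E F : R} {p q : ℕ}

lemma IsDrazin.commute (h : IsDrazin T E p) : Commute T E := h.comm

lemma IsDrazin.mono (h : IsDrazin T E p) (hpq : p ≤ q) : IsDrazin T E q := by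
  refine ⟨h.comm, h.outer, ?_⟩
  obtain ⟨j, rfl⟩ := Nat.exists_eq_add_of_le' hpq
  rw [add_assoc, pow_add, mul_assoc, h.pow_succ_mul, pow_add]

lemma IsDrazin.pow_add_mul_pow (h : IsDrazin T E p) (i : ℕ) : T ^ (p + i) * E ^ i = T ^ p := by
  induction i with
  | zero => simp
  | succ i ih =>
    rw [pow_succ' E, ← mul_assoc, ← add_assoc, (h.mono (Nat.le_add_right p i)).pow_succ_mul, ih]

lemma IsDrazin.pow_succ_mul_pow (h : IsDrazin T E p) (i : ℕ) : E ^ (i + 1) * T ^ i = E := by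
  induction i with
  | zero => simp
  | succ i ih =>
    calc E ^ (i + 1 + 1) * T ^ (i + 1) = E * (E ^ (i + 1) * T ^ i) * T := by
          rw [pow_succ' E, pow_succ T]; simp only [mul_assoc]
      _ = E := by rw [ih, mul_assoc, ← h.comm, ← mul_assoc, h.outer]

/-- The idempotents `E * T` and `F * T` both equal their product. The two exponents may differ,
which later allows comparing inverses built from `W * A` and from `A * W`. -/
lemma IsDrazin.unique (hE : IsDrazin T E p) (hF : IsDrazin T F q) : E = F := by
  have hE' := hE.mono (le_max_left p q)
  have hF' := hF.mono (le_max_right p q)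
  generalize max p q = N at hE' hF'
  have e1 : E * T = E * T * (F * T) := by
    calc E * T = E ^ (N + 1) * T ^ N * T := by rw [hE.pow_succ_mul_pow]
      _ = E ^ (N + 1) * (T ^ (N + 1) * F) * T := by rw [hF'.pow_succ_mul]
      _ = E ^ (N + 1) * T ^ N * T * (F * T) := by
          rw [pow_succ T]; simp only [mul_assoc]
      _ = E * T * (F * T) := by rw [hE.pow_succ_mul_pow]
  have e2 : F * T = E * T * (F * T) := by
    have h : T ^ N = E * T * T ^ N := by
      conv_lhs => rw [← hE'.pow_succ_mul]
      rw [(hE.commute.pow_left _).eq, pow_succ', ← mul_assoc]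
    have hF3 : F * T = T ^ N * (F ^ (N + 1) * T) := by
      rw [← mul_assoc, (hF.commute.pow_pow N (N + 1)).eq, hF.pow_succ_mul_pow]
    rw [hF3]
    conv_lhs => rw [h]
    simp only [mul_assoc]
  calc E = E * T * E := hE.outer.symm
    _ = F * T * E := by rw [e1, ← e2]
    _ = F * (E * T) := by rw [mul_assoc, hE.comm]
    _ = F * (F * T) := by rw [e1, ← e2]
    _ = F := by rw [← hF.comm, ← mul_assoc, hF.outer]

end IsDrazin

end Drazin

/-! ### The weighted Drazin inverse and its reduction to the Drazin inverse of `W * A`. -/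

section WeightedDrazin

variable {m n : ℕ}

/-- Stabilization on both sides gives `T^p = T^(2p+1) Y = Z T^(2p+1)`. Then `T^p Y = Z T^p` is the
inverse, and having both forms makes it commute with `T`. -/
lemma exists_isDrazin {T : Matrix (Fin n) (Fin n) ℍ[ℝ]} {p : ℕ}
    (hp : rk (T ^ (p + 1)) = rk (T ^ p)) : ∃ E : Matrix (Fin n) (Fin n) ℍ[ℝ], IsDrazin T E p := by
  obtain ⟨Y, hY⟩ := exists_pow_eq_pow_mul hp le_rfl (p + 1)
  obtain ⟨Z, hZ⟩ := exists_pow_eq_mul_pow hp le_rfl (p + 1)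
  have h1 : T ^ p * Y = Z * T ^ p := by
    conv_lhs => rw [hZ, mul_assoc, ← hY]
  have h2 : T * (T ^ p * Y) = Z * T ^ p * T := by
    calc T * (T ^ p * Y) = T ^ p * T * Y := by rw [← mul_assoc, ← pow_succ', pow_succ]
      _ = Z * T * (T ^ (p + (p + 1)) * Y) := by
        conv_lhs => rw [hZ, mul_assoc Z, ← pow_succ, pow_succ']
        simp only [mul_assoc]
      _ = Z * T ^ p * T := by rw [← hY, mul_assoc, ← pow_succ', pow_succ, mul_assoc]
  refine ⟨T ^ p * Y, ⟨by rw [h2, h1], ?_, ?_⟩⟩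
  · calc T ^ p * Y * T * (T ^ p * Y) = Z * (T ^ p * T * T ^ p * Y) := by
          rw [h1]; simp only [mul_assoc]; rw [← h1]
      _ = Z * (T ^ (p + (p + 1)) * Y) := by
          rw [mul_assoc (T ^ p), ← pow_succ', ← pow_add]
      _ = T ^ p * Y := by rw [← hY, h1]
  · rw [← mul_assoc, ← pow_add, add_comm (p + 1), ← hY]

variable {A : Matrix (Fin m) (Fin n) ℍ[ℝ]} {W : Matrix (Fin n) (Fin m) ℍ[ℝ]}

lemma isWeightedDrazin_of_isDrazin {E : Matrix (Fin m) (Fin m) ℍ[ℝ]}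
    (hE : IsDrazin (A * W) E (ind (A * W))) : IsWeightedDrazin A W (E * E * A) := by
  have h1 : A * W * E * E = E := by rw [hE.comm, hE.outer]
  refine ⟨?_, ?_, ?_⟩
  · rw [Matrix.mul_assoc _ _ W, Matrix.mul_assoc (E * E), Matrix.mul_assoc E E, ← hE.comm,
      ← Matrix.mul_assoc E, hE.outer, hE.pow_succ_mul]
  · calc E * E * A * W * A * W * (E * E * A) = E * E * (A * W) * (A * W * E * E) * A := by
          simp only [Matrix.mul_assoc]
      _ = E * (E * (A * W) * E) * A := by rw [h1]; simp only [Matrix.mul_assoc]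
      _ = E * E * A := by rw [hE.outer]
  · calc A * W * (E * E * A) = A * W * E * E * A := by simp only [Matrix.mul_assoc]
      _ = E * (A * W) * E * A := by rw [h1, hE.outer]
      _ = E * (E * (A * W)) * A := by rw [Matrix.mul_assoc E, hE.comm]
      _ = E * E * A * W * A := by simp only [Matrix.mul_assoc]

lemma IsWeightedDrazin.isDrazin_mul {X : Matrix (Fin m) (Fin n) ℍ[ℝ]}
    (hX : IsWeightedDrazin A W X) : IsDrazin (A * W) (X * W) (ind (A * W)) := by
  obtain ⟨h1, h2, h3⟩ := hX
  refine ⟨?_, ?_, ?_⟩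
  · rw [← Matrix.mul_assoc, h3]; simp only [Matrix.mul_assoc]
  · rw [← Matrix.mul_assoc, ← Matrix.mul_assoc, h2]
  · rw [← Matrix.mul_assoc, h1]

lemma IsWeightedDrazin.eq {X : Matrix (Fin m) (Fin n) ℍ[ℝ]} (hX : IsWeightedDrazin A W X) :
    X = X * W * (X * W) * A := by
  obtain ⟨-, h2, h3⟩ := hX
  calc X = X * W * (A * W * X) := by rw [← Matrix.mul_assoc, ← Matrix.mul_assoc, h2]
    _ = _ := by rw [h3]; simp only [Matrix.mul_assoc]

lemma existsUnique_isWeightedDrazin (A : Matrix (Fin m) (Fin n) ℍ[ℝ])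
    (W : Matrix (Fin n) (Fin m) ℍ[ℝ]) : ∃! X, IsWeightedDrazin A W X := by
  obtain ⟨E, hE⟩ := exists_isDrazin (ind_spec (A * W)).2
  refine ⟨E * E * A, isWeightedDrazin_of_isDrazin hE, fun X hX => ?_⟩
  rw [hX.eq, hX.isDrazin_mul.unique hE]

lemma isWeightedDrazin_weightedDrazin (A : Matrix (Fin m) (Fin n) ℍ[ℝ])
    (W : Matrix (Fin n) (Fin m) ℍ[ℝ]) : IsWeightedDrazin A W (weightedDrazin A W) := by
  have h : ∃ X, IsWeightedDrazin A W X := (existsUnique_isWeightedDrazin A W).exists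
  rw [weightedDrazin, dif_pos h]
  exact h.choose_spec

lemma mul_pow_mul_comm (A : Matrix (Fin m) (Fin n) ℍ[ℝ]) (W : Matrix (Fin n) (Fin m) ℍ[ℝ])
    (p : ℕ) : (W * A) ^ (p + 1) = W * (A * W) ^ p * A := by
  induction p with
  | zero => simp
  | succ p ih =>
    rw [pow_succ, ih, pow_succ (A * W)]
    simp only [Matrix.mul_assoc]

/-- Passing from `A * W` to `W * A` through `(WA)^(p+1) = W (AW)^p A` costs one in the exponent. -/
lemma IsWeightedDrazin.isDrazin_mul_left {X : Matrix (Fin m) (Fin n) ℍ[ℝ]}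
    (hX : IsWeightedDrazin A W X) : IsDrazin (W * A) (W * X) (ind (A * W) + 1) := by
  obtain ⟨h1, h2, h3⟩ := hX
  refine ⟨?_, ?_, ?_⟩
  · calc W * A * (W * X) = W * (A * W * X) := by simp only [Matrix.mul_assoc]
      _ = W * X * (W * A) := by rw [h3]; simp only [Matrix.mul_assoc]
  · calc W * X * (W * A) * (W * X) = W * (X * W * A * W * X) := by simp only [Matrix.mul_assoc]
      _ = W * X := by rw [h2]
  · calc (W * A) ^ (ind (A * W) + 1 + 1) * (W * X)
        = W * (A * W) ^ (ind (A * W) + 1) * (A * W * X) := by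
          rw [mul_pow_mul_comm]; simp only [Matrix.mul_assoc]
      _ = W * ((A * W) ^ (ind (A * W) + 1) * X * W) * A := by
          rw [h3]; simp only [Matrix.mul_assoc]
      _ = (W * A) ^ (ind (A * W) + 1) := by rw [h1, mul_pow_mul_comm]

/-- The weighted DMP inverse in terms of the Drazin inverse of `W * A`. -/
lemma exists_isDrazin_wdmp_eq (A : Matrix (Fin m) (Fin n) ℍ[ℝ]) (W : Matrix (Fin n) (Fin m) ℍ[ℝ])
    {k : ℕ} (hk : ind (W * A) ≤ k) : ∃ E : Matrix (Fin n) (Fin n) ℍ[ℝ], IsDrazin (W * A) E k ∧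
      wdmp A W = E * (W * A) * moorePenrose A := by
  obtain ⟨E, hE⟩ := exists_isDrazin (ind_spec (W * A)).2
  refine ⟨E, hE.mono hk, ?_⟩
  rw [wdmp, (isWeightedDrazin_weightedDrazin A W).isDrazin_mul_left.unique hE]
  simp only [Matrix.mul_assoc]

lemma rk_pow_eq {T : Matrix (Fin n) (Fin n) ℍ[ℝ]} {k l : ℕ} (hk : ind T ≤ k) (hkl : k ≤ l) :
    rk (T ^ l) = rk (T ^ k) := by
  obtain ⟨i, rfl⟩ := Nat.exists_eq_add_of_le hkl
  obtain ⟨Y, hY⟩ := exists_pow_eq_pow_mul (ind_spec T).2 hk i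
  exact rk_eq_of_eq_mul (pow_add T k i) hY

end WeightedDrazin

/-! ### Drazin inverses from inner inverses, and entries as quotients of minor sums. -/

section Representation

variable {m n : ℕ} {U E : Matrix (Fin n) (Fin n) ℍ[ℝ]} {k : ℕ}

/-- Both outer factors `U^k` absorb a power `U^(2k+1)` at the price of `E^(k+1)`, so any inner
inverse `G` gives the same result. -/
lemma IsDrazin.eq_pow_mul_mul_pow (hE : IsDrazin U E k) {G : Matrix (Fin n) (Fin n) ℍ[ℝ]}
    (hG : U ^ (2 * k + 1) * G * U ^ (2 * k + 1) = U ^ (2 * k + 1)) : U ^ k * G * U ^ k = E := by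
  have h1 : U ^ k = U ^ (2 * k + 1) * E ^ (k + 1) := by
    rw [← hE.pow_add_mul_pow (k + 1)]
    congr 2
    omega
  have h2 : U ^ k = E ^ (k + 1) * U ^ (2 * k + 1) := by
    rw [h1]; exact (hE.commute.pow_pow _ _).eq
  calc U ^ k * G * U ^ k
      = E ^ (k + 1) * U ^ (2 * k + 1) * G * (U ^ (2 * k + 1) * E ^ (k + 1)) := by
        conv_lhs => rw [h1]
        rw [(hE.commute.pow_pow (2 * k + 1) (k + 1)).eq]
    _ = E ^ (k + 1) * (U ^ (2 * k + 1) * G * U ^ (2 * k + 1)) * E ^ (k + 1) := by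
        simp only [mul_assoc]
    _ = E ^ (k + 1) * U ^ k := by rw [hG, mul_assoc, ← h1]
    _ = E := hE.pow_succ_mul_pow k

lemma IsDrazin.mul_eq_of_inner (hE : IsDrazin U E k) {G : Matrix (Fin n) (Fin n) ℍ[ℝ]}
    (hG : U ^ (2 * k + 1) * G * U ^ (2 * k + 1) = U ^ (2 * k + 1)) :
    U * (U ^ k * G) * U ^ (2 * k) * G * U ^ (k + 1) = E * U := by
  have h := hE.eq_pow_mul_mul_pow hG
  calc U * (U ^ k * G) * U ^ (2 * k) * G * U ^ (k + 1)
      = U * (U ^ k * G * U ^ k) * (U ^ k * G * U ^ k) * U := by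
        rw [two_mul, pow_add, pow_succ]; simp only [mul_assoc]
    _ = E * U := by rw [h, hE.comm, hE.outer]

lemma IsDrazin.mul_eq_of_isHermitian (hE : IsDrazin U E k) (hU : U.IsHermitian)
    {G : Matrix (Fin n) (Fin n) ℍ[ℝ]} (hG : U ^ (k + 2) * G * U ^ (k + 2) = U ^ (k + 2)) :
    U ^ (k + 1) * G * U = E * U := by
  -- Cancelling powers of a Hermitian matrix lowers the exponent to `1`, so that `U` itself, not
  -- just `U^k`, is a multiple of `U^(k+2)`.
  have h1 : IsDrazin U E 1 := by
    refine ⟨hE.comm, hE.outer, ?_⟩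
    have h0 : U ^ (k + 1) * (U * E - 1) = 0 := by
      rw [mul_sub, ← mul_assoc, ← pow_succ, (hE.mono (Nat.le_succ k)).pow_succ_mul, mul_one,
        sub_self]
    have h2 := mul_eq_zero_of_pow_mul hU h0
    rw [Matrix.mul_sub, Matrix.mul_one, sub_eq_zero, ← mul_assoc] at h2
    rw [pow_one, one_add_one_eq_two, sq, h2]
  have h2 : U = U ^ (k + 2) * E ^ (k + 1) := by
    have := h1.pow_add_mul_pow (k + 1)
    rw [pow_one, show 1 + (k + 1) = k + 2 by omega] at this
    exact this.symm
  have h3 : U ^ (k + 1) = E * U ^ (k + 2) := by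
    rw [← (hE.commute.pow_left _).eq]
    exact ((hE.mono (Nat.le_succ k)).pow_succ_mul).symm
  calc U ^ (k + 1) * G * U = E * U ^ (k + 2) * G * (U ^ (k + 2) * E ^ (k + 1)) := by
        rw [← h3, ← h2]
    _ = E * (U ^ (k + 2) * G * U ^ (k + 2)) * E ^ (k + 1) := by simp only [mul_assoc]
    _ = E * U := by rw [hG, mul_assoc, ← h2]

lemma smul_div_coe {c : ℝ} (hc : c ≠ 0) (x : ℍ[ℝ]) : (c • x) / (c : ℍ[ℝ]) = x := by
  have hc' : (c : ℍ[ℝ]) ≠ 0 := fun h => hc (Quaternion.coe_injective h)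
  rw [← Quaternion.coe_mul_eq_smul, Quaternion.coe_commutes, mul_div_cancel_right₀ _ hc']

/-- If `C * innerInv M` is a real multiple of `Y`, then the entries of `Y` are quotients of
sums of minors. -/
lemma apply_eq_rowMinorSum_div {M : Matrix (Fin m) (Fin m) ℍ[ℝ]} (hM : M.IsHermitian)
    {C Y : Matrix (Fin n) (Fin m) ℍ[ℝ]} {c : ℝ} (hc : c ≠ 0) (h : C * innerInv M = c • Y)
    (i : Fin n) (j : Fin m) :
    Y i j = rowMinorSum M (rk M) j (C.row i) / (minorSum M (rk M) * (c : ℍ[ℝ])) := by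
  have h1 := of_rowMinorSum_eq hM
    (X := Matrix.of fun i j => rowMinorSum M (rk M) j (C.row i)) (C := C) fun _ _ => rfl
  have h2 := congrFun (congrFun h1 i) j
  rw [Matrix.of_apply] at h2
  rw [h2, h, smul_smul, Matrix.smul_apply, minorSum_eq_coe hM, ← Quaternion.coe_mul,
    Quaternion.re_coe, smul_div_coe (mul_ne_zero (re_minorSum_rk_ne_zero hM) hc)]

end Representation

end QMat

theorem theorem4p5 (m n r r₁ k : ℕ)
    (A : Matrix (Fin m) (Fin n) ℍ[ℝ]) (W : Matrix (Fin n) (Fin m) ℍ[ℝ])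
    (U : Matrix (Fin n) (Fin n) ℍ[ℝ])
    (hr : QMat.rk A = r) (hW : W ≠ 0) (hU : U = W * A)
    (hk : k = max (QMat.ind (W * A)) (QMat.ind (A * W)))
    (hr₁ : QMat.rk (U ^ k) = r₁) :
    -- the generalized inverses that enter the weighted DMP inverse exist and are unique
    (∃! X, QMat.IsWeightedDrazin A W X) ∧ (∃! Y, QMat.IsMoorePenrose A Y) ∧
    -- the denominators do not vanish
    QMat.minorSum (A * Aᴴ) r ≠ 0 ∧
    QMat.minorSum (U ^ (2 * k + 1) * (U ^ (2 * k + 1))ᴴ) r₁ ≠ 0 ∧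
    ((W * A).IsHermitian → QMat.minorSum ((W * A) ^ (k + 2)) r₁ ≠ 0) ∧
    -- (i) arbitrary `W * A`
    (∀ Ucheck Φ Φhat Ω : Matrix (Fin n) (Fin n) ℍ[ℝ], ∀ Ωtilde : Matrix (Fin n) (Fin m) ℍ[ℝ],
      Ucheck = U ^ k * (U ^ (2 * k + 1))ᴴ →
      (∀ l q, Φ l q =
        QMat.rowMinorSum (U ^ (2 * k + 1) * (U ^ (2 * k + 1))ᴴ) r₁ q (Ucheck.row l)) →
      Φhat = W * A * Φ * U ^ (2 * k) * (U ^ (2 * k + 1))ᴴ →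
      (∀ i s, Ω i s =
        QMat.rowMinorSum (U ^ (2 * k + 1) * (U ^ (2 * k + 1))ᴴ) r₁ s (Φhat.row i)) →
      Ωtilde = Ω * (W * A) ^ (k + 1) * Aᴴ →
      ∀ (i : Fin n) (j : Fin m), QMat.wdmp A W i j =
        QMat.rowMinorSum (A * Aᴴ) r j (Ωtilde.row i) /
          (QMat.minorSum (A * Aᴴ) r *
            QMat.minorSum (U ^ (2 * k + 1) * (U ^ (2 * k + 1))ᴴ) r₁ ^ 2)) ∧
    -- (ii) Hermitian `W * A`
    ((W * A).IsHermitian →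
      ∀ Uhat Ω : Matrix (Fin n) (Fin n) ℍ[ℝ], ∀ Ωtilde : Matrix (Fin n) (Fin m) ℍ[ℝ],
      Uhat = (W * A) ^ (k + 1) →
      (∀ i s, Ω i s = QMat.rowMinorSum ((W * A) ^ (k + 2)) r₁ s (Uhat.row i)) →
      Ωtilde = Ω * W * A * Aᴴ →
      ∀ (i : Fin n) (j : Fin m), QMat.wdmp A W i j =
        QMat.rowMinorSum (A * Aᴴ) r j (Ωtilde.row i) /
          (QMat.minorSum (A * Aᴴ) r * QMat.minorSum ((W * A) ^ (k + 2)) r₁)) := by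
  have hind : QMat.ind U ≤ k := by rw [hk, hU]; exact le_max_left _ _
  obtain ⟨E, hE, hwdmp⟩ := QMat.exists_isDrazin_wdmp_eq A W (hU ▸ hind)
  rw [QMat.moorePenrose_eq] at hwdmp
  have hA := Matrix.isHermitian_mul_conjTranspose_self A
  have hrA : QMat.rk (A * Aᴴ) = r := by rw [QMat.rk_mul_conjTranspose, hr]
  have hB := Matrix.isHermitian_mul_conjTranspose_self (U ^ (2 * k + 1))
  have hrB : QMat.rk (U ^ (2 * k + 1) * (U ^ (2 * k + 1))ᴴ) = r₁ := by
    rw [QMat.rk_mul_conjTranspose, QMat.rk_pow_eq hind (by omega), hr₁]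
  have hrH : QMat.rk (U ^ (k + 2)) = r₁ := by rw [QMat.rk_pow_eq hind (by omega), hr₁]
  rw [← hU] at hE hwdmp ⊢
  refine ⟨QMat.existsUnique_isWeightedDrazin A W, QMat.existsUnique_isMoorePenrose A,
    hrA ▸ QMat.minorSum_rk_ne_zero hA, hrB ▸ QMat.minorSum_rk_ne_zero hB,
    fun hUH => hrH ▸ QMat.minorSum_rk_ne_zero (hUH.pow _), ?_, ?_⟩
  · intro Ucheck Φ Φhat Ω Ωtilde hUc hΦ hΦhat hΩ hΩt i j
    have hV := QMat.mul_conjTranspose_innerInv_mul (U ^ (2 * k + 1))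
    set V := U ^ (2 * k + 1) with hV_def
    rw [← hrB] at hΦ hΩ ⊢
    have hΦ' := QMat.of_rowMinorSum_eq hB hΦ
    have hΩ' := QMat.of_rowMinorSum_eq hB hΩ
    have hd := QMat.re_minorSum_rk_ne_zero hB
    rw [QMat.minorSum_eq_coe hB, ← Quaternion.coe_pow, ← hrA]
    -- `Φ` and `Ω` each carry one factor `d`, which accounts for the square in the denominator.
    generalize (QMat.minorSum (V * Vᴴ) (QMat.rk (V * Vᴴ))).re = d at hd hΦ' hΩ'
    refine QMat.apply_eq_rowMinorSum_div hA (pow_ne_zero 2 hd) ?_ i j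
    have key := hE.mul_eq_of_inner (G := Vᴴ * QMat.innerInv (V * Vᴴ))
      (by rw [← mul_assoc]; exact hV)
    rw [hwdmp, ← key, hΩt, hΩ', hΦhat, hΦ', hUc]
    simp only [Matrix.mul_smul, Matrix.smul_mul, smul_smul, Matrix.mul_assoc, sq]
  · intro hUH Uhat Ω Ωtilde hUh hΩ hΩt i j
    have hH := hUH.pow (k + 2)
    rw [← hrH] at hΩ ⊢
    have hΩ' := QMat.of_rowMinorSum_eq hH hΩ
    have hd := QMat.re_minorSum_rk_ne_zero hH
    rw [QMat.minorSum_eq_coe hH, ← hrA]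
    refine QMat.apply_eq_rowMinorSum_div hA hd ?_ i j
    have key := hE.mul_eq_of_isHermitian hUH (QMat.mul_innerInv_mul hH)
    rw [hwdmp, ← key, hΩt, hΩ', hUh, Matrix.mul_assoc _ W A, ← hU]
    simp only [Matrix.smul_mul, Matrix.mul_assoc]
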